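/- Write $S^1=\mathbb{R}/2\pi\mathbb{Z}$. Let $(B,\omega)$ be a closed connected symplectic manifold and let $\pi\colon M\to B$ be a Boothby–Wang bundle over it, i.e. a smooth principal $S^1$-bundle with a connection $1$-form $\alpha$ (an $S^1$-invariant $1$-form that equals $1$ on the vector field generating the $S^1$-action) whose curvature is $\omega$, that is, $\mathrm{d}\alpha=\pi^*\omega$. Let $R$ be the Reeb vector field of $\alpha$, defined by $\alpha(R)=1$ and $i_R\mathrm{d}\alpha=0$. Let $H\colon B\to\mathbb{R}$ be a smooth function and let $X$ be its Hamiltonian vector field, with the sign convention $\omega(X,\cdot)=-\mathrm{d}H$. Let $X_{\mathrm h}$ be the horizontal lift of $X$ to $M$, defined by $\alpha(X_{\mathrm h})=0$ and $T\pi(X_{\mathrm h})=X$. Suppose that the flow of $X$ is a smooth $S^1$-action on $B$ (in particular it is $2\pi$-periodic), that $H>0$, and that $H(p_0)\in\mathbb{N}$ for some point $p_0\in B$ with $X(p_0)=0$. Then the flow of the lifted vector field $$\widetilde X:=(H\circ\pi)\,R+X_{\mathrm h}$$ is a smooth $S^1$-action on $M$. Moreover, $\alpha$ is a contact form, and the flows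 of $R$ and $\widetilde X$ together define a strict contact $T^2$-action on $M$: there is a smooth action of $T^2=S^1\times S^1$ on $M$ that preserves $\alpha$ and whose first and second circle factors act by the flow of $R$ and the flow of $\widetilde X$, respectively. -/

import Mathlib

open scoped Manifold ContDiff

noncomputable section

namespace BoothbyWang

section Forms

variable {E : Type*} [NormedAddCommGroup E] [NormedSpace ℝ E]
  {F : Type*} [NormedAddCommGroup F] [NormedSpace ℝ F]

/-- A (not necessarily continuous) vector field on a manifold modelled on `E`. -/
abbrev VectorField (E : Type*) [NormedAddCommGroup E] [NormedSpace ℝ E]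
    (M : Type*) [TopologicalSpace M] [ChartedSpace E M] : Type _ :=
  (x : M) → TangentSpace 𝓘(ℝ, E) x

/-- A (not necessarily continuous) differential `k`-form on a manifold modelled on `E`. -/
abbrev Form (E : Type*) [NormedAddCommGroup E] [NormedSpace ℝ E]
    (M : Type*) [TopologicalSpace M] [ChartedSpace E M] (k : ℕ) : Type _ :=
  (x : M) → TangentSpace 𝓘(ℝ, E) x [⋀^Fin k]→L[ℝ] ℝ

variable {M : Type*} [TopologicalSpace M] [ChartedSpace E M]
  {N : Type*} [TopologicalSpace N] [ChartedSpace F N]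

/-- The pullback `f^*β` of a differential form along a (differentiable) map. -/
def Form.pullback {k : ℕ} (f : M → N) (β : Form F N k) : Form E M k :=
  fun x => (β (f x)).compContinuousLinearMap (mfderiv 𝓘(ℝ, E) 𝓘(ℝ, F) f x)

/-- The form `β` written in the preferred chart at `x₀`: its pullback along the inverse of that
chart, a form on the open subset `(extChartAt 𝓘(ℝ, E) x₀).target` of `E`. -/
def Form.inChart {k : ℕ} (β : Form E M k) (x₀ : M) : E → E [⋀^Fin k]→L[ℝ] ℝ :=
  fun y => (β ((extChartAt 𝓘(ℝ, E) x₀).symm y)).compContinuousLinearMap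
    (mfderiv 𝓘(ℝ, E) 𝓘(ℝ, E) (extChartAt 𝓘(ℝ, E) x₀).symm y)

/-- A form is smooth if it is smooth in charts. -/
def Form.IsSmooth {k : ℕ} (β : Form E M k) : Prop :=
  ∀ x₀ : M, ContDiffOn ℝ ∞ (β.inChart x₀) (extChartAt 𝓘(ℝ, E) x₀).target

/-- The exterior derivative of a smooth form, computed at each point `x` in the preferred chart
at `x`. It is normalised so that
`dα(V, W) = V (α W) - W (α V) - α [V, W]` for a `1`-form `α`. -/
def Form.d {k : ℕ} (β : Form E M k) : Form E M (k + 1) :=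
  fun x => (extDeriv (β.inChart x) (extChartAt 𝓘(ℝ, E) x x)).compContinuousLinearMap
    (mfderiv 𝓘(ℝ, E) 𝓘(ℝ, E) (extChartAt 𝓘(ℝ, E) x) x)

/-- Symplectic forms: smooth, closed, non-degenerate `2`-forms. -/
structure IsSymplecticForm (Ω : Form E M 2) : Prop where
  smooth : Ω.IsSmooth
  closed : ∀ x, Ω.d x = 0
  nondegenerate : ∀ x (v : TangentSpace 𝓘(ℝ, E) x),
    (∀ w : TangentSpace 𝓘(ℝ, E) x, Ω x ![v, w] = 0) → v = 0

/-- Contact forms: smooth `1`-forms `α` without zeros such that `dα` is non-degenerate on the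
hyperplane field `ker α`; in dimension `2n + 1` this says that `α ∧ (dα)^n` has no zeros, and in
even dimensions there are none. -/
structure IsContactForm (α : Form E M 1) : Prop where
  smooth : α.IsSmooth
  ne_zero : ∀ x, α x ≠ 0
  nondegenerate : ∀ x (v : TangentSpace 𝓘(ℝ, E) x), α x ![v] = 0 →
    (∀ w : TangentSpace 𝓘(ℝ, E) x, α x ![w] = 0 → α.d x ![v, w] = 0) → v = 0

/-- `X` is the Hamiltonian vector field of `H`, with the sign convention `Ω(X, ·) = -dH`. -/
def IsHamiltonianVectorField (Ω : Form E M 2) (H : M → ℝ) (X : VectorField E M) : Prop :=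
  ∀ x (v : TangentSpace 𝓘(ℝ, E) x), Ω x ![X x, v] = -(mfderiv 𝓘(ℝ, E) 𝓘(ℝ, ℝ) H x v : ℝ)

/-- `R` is the Reeb vector field of `α`: `α(R) = 1` and `dα(R, ·) = 0`. -/
def IsReebVectorField (α : Form E M 1) (R : VectorField E M) : Prop :=
  ∀ x, α x ![R x] = 1 ∧ ∀ v : TangentSpace 𝓘(ℝ, E) x, α.d x ![R x, v] = 0

/-- `Xh` is the `α`-horizontal lift of the vector field `X` along `π`: `α(Xh) = 0` and
`Tπ(Xh) = X`. -/
def IsHorizontalLift (π : M → N) (α : Form E M 1) (X : VectorField F N)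
    (Xh : VectorField E M) : Prop :=
  ∀ x, α x ![Xh x] = 0 ∧ mfderiv 𝓘(ℝ, E) 𝓘(ℝ, F) π x (Xh x) = X (π x)

end Forms

section Actions

variable {E : Type*} [NormedAddCommGroup E] [NormedSpace ℝ E]
  {M : Type*} [TopologicalSpace M] [ChartedSpace E M]
  {F : Type*} [NormedAddCommGroup F] [NormedSpace ℝ F]
  {B : Type*} [TopologicalSpace B] [ChartedSpace F B]

/-- The circle group is `ℝ/2πℤ`, via `t ↦ exp(it)`. The vector field `X` defines (generates) a
circle action if there is a smooth action of the circle for which every curve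
`t ↦ exp(it) • x` is an integral curve of `X`, i.e. whose flow is the flow of `X`. -/
def GeneratesCircleAction (X : VectorField E M) : Prop :=
  ∃ _ : MulAction Circle M, ContMDiffSMul (𝓡 1) 𝓘(ℝ, E) ∞ Circle M ∧
    ∀ x : M, IsMIntegralCurve (I := 𝓘(ℝ, E)) (fun t : ℝ => Circle.exp t • x) X

/-- The vector fields `X` and `Y` generate a strict contact action of the torus
`T² = S¹ × S¹` on the manifold with contact form `α`: there is a smooth `T²`-action preserving
`α` whose first and second circle factors act by the flows of `X` and `Y` respectively. -/
def GenerateStrictContactTorusAction (α : Form E M 1) (X Y : VectorField E M) : Prop :=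
  IsContactForm α ∧
  ∃ _ : MulAction (Circle × Circle) M,
    ContMDiffSMul ((𝓡 1).prod (𝓡 1)) 𝓘(ℝ, E) ∞ (Circle × Circle) M ∧
    (∀ x : M, IsMIntegralCurve (I := 𝓘(ℝ, E))
      (fun t : ℝ => ((Circle.exp t, 1) : Circle × Circle) • x) X) ∧
    (∀ x : M, IsMIntegralCurve (I := 𝓘(ℝ, E))
      (fun t : ℝ => ((1, Circle.exp t) : Circle × Circle) • x) Y) ∧
    ∀ (g : Circle × Circle) (x : M), α.pullback (fun y : M => g • y) x = α x

/-- `π : M → B` is a smooth principal circle bundle for the given circle action on `M`. -/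
structure IsPrincipalCircleBundle [MulAction Circle M] (π : M → B) : Prop where
  smooth_proj : ContMDiff 𝓘(ℝ, E) 𝓘(ℝ, F) ∞ π
  smooth_action : ContMDiffSMul (𝓡 1) 𝓘(ℝ, E) ∞ Circle M
  proj_smul : ∀ (z : Circle) (x : M), π (z • x) = π x
  /-- Local triviality: over a neighbourhood `U` of each point there is an equivariant
  diffeomorphism `π⁻¹(U) ≅ U × S¹` over `U`. -/
  locally_trivial : ∀ b : B, ∃ (U : Set B) (e : OpenPartialHomeomorph M (B × Circle)),
    IsOpen U ∧ b ∈ U ∧ e.source = π ⁻¹' U ∧ e.target = U ×ˢ Set.univ ∧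
    ContMDiffOn 𝓘(ℝ, E) (𝓘(ℝ, F).prod (𝓡 1)) ∞ e e.source ∧
    ContMDiffOn (𝓘(ℝ, F).prod (𝓡 1)) 𝓘(ℝ, E) ∞ e.symm e.target ∧
    ∀ x ∈ e.source, (e x).1 = π x ∧ ∀ z : Circle, e (z • x) = (π x, z * (e x).2)

/-- The vector field generating a smooth circle action, `x ↦ d/dt|_{t=0} exp(it) • x`. -/
def fundamentalVectorField [MulAction Circle M] : VectorField E M :=
  fun x => mfderiv 𝓘(ℝ, ℝ) 𝓘(ℝ, E) (fun t : ℝ => Circle.exp t • x) 0 (1 : ℝ)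

/-- `α` is a connection `1`-form for the given circle action: a smooth invariant form that takes
the value `1` on the vector field generating the action (of period `2π`). -/
structure IsConnectionForm [MulAction Circle M] (α : Form E M 1) : Prop where
  smooth : α.IsSmooth
  invariant : ∀ (z : Circle) (x : M), α.pullback (fun y : M => z • y) x = α x
  normalised : ∀ x : M, α x ![fundamentalVectorField x] = 1

/-- `π : (M, α) → (B, Ω)` is a Boothby–Wang (prequantisation) bundle: a principal circle bundle
with a connection form `α` whose curvature is `Ω`, that is `dα = π^*Ω`. -/
structure IsBoothbyWangBundle [MulAction Circle M] (π : M → B) (α : Form E M 1)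
    (Ω : Form F B 2) : Prop where
  symplectic : IsSymplecticForm Ω
  bundle : IsPrincipalCircleBundle (E := E) (F := F) π
  connection : IsConnectionForm α
  curvature : ∀ x, α.d x = Ω.pullback π x

/-- The vector field `(H ∘ π) R + Xh`. -/
def liftedVectorField (π : M → B) (H : B → ℝ) (R Xh : VectorField E M) : VectorField E M :=
  fun x => H (π x) • R x + Xh x

end Actions

end BoothbyWang

end

/-!
The lifted field `Y = (H ∘ π) R + Xₕ` is characterised by `Tπ(Y) = X` and `α(Y) = H ∘ π`, because the
tangent spaces of `M` are the direct sums of `ker α` and the vertical lines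
(`eq_of_mfderiv_eq_of_apply_eq`); the Reeb field `R` generates the principal action
(`IsBoothbyWangBundle.reeb_eq`).

*The flow exists and is smooth.* If `σ` is a local section and `ρ` is the flow of `X`, then
`(t, z • σ(b)) ↦ exp(ih(t, b)) • z • σ(ρ_t(b))` is a local flow of `Y` as soon as
`∂h/∂t = H(ρ_t(b)) - α(∂/∂t σ(ρ_t(b)))`. So `h` is an integral depending smoothly on the
parameter `b` (`contDiffOn_primitive`), and no theorem on the smooth dependence of solutions of
ordinary differential equations on initial values is needed. The time of existence depends on the
base point only, and the base is compact; with uniqueness of integral curves the local flows extend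
to a global smooth flow `Φ` (`IsLift.exists_isFlow`).

*The flow preserves `α`.* This is Cartan's formula `L_Y α = d(α(Y)) + i_Y dα = π^*(dH + i_X Ω) = 0`. It
is proved for maps `c` from a vector space into `M`, for which
`∂_v (α(∂_w c)) - ∂_w (α(∂_v c)) = dα(∂_v c, ∂_w c)` (`Form.IsSmooth.d_apply_mfderiv`); applied to
`c(t, y) = Φ_t(y)` it shows that `α(TΦ_t v)` does not depend on `t` (`IsLift.pullback_flow`).

*The flow is `2π`-periodic.* It covers `ρ` and commutes with the principal action, so `Φ_{2π}` is a
gauge transformation `x ↦ ζ(π(x)) • x`. It changes `α` by the logarithmic derivative of `ζ`, hence `ζ`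
is locally constant, and constant since `B` is connected (`IsConnectionForm.eq_self_of_pullback_eq`).
Over the zero `p₀` of `X` the flow is the rotation with speed `H(p₀) ∈ ℕ`, so `ζ = 1`.

The circle action given by `Φ` commutes with the principal one, and together they form the torus
action.
-/

noncomputable section

namespace BoothbyWang

open scoped Manifold ContDiff
open Set Filter Topology

/-! ### Calculus of `1`-forms along maps from vector spaces -/

section FormCalculus

variable {E : Type*} [NormedAddCommGroup E] [NormedSpace ℝ E]
  {M : Type*} [TopologicalSpace M] [ChartedSpace E M]
  {P : Type*} [NormedAddCommGroup P] [NormedSpace ℝ P]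

/-- A `1`-form as a family of continuous linear functionals on the tangent spaces. -/
def Form.toCLM (α : Form E M 1) (x : M) : TangentSpace 𝓘(ℝ, E) x →L[ℝ] ℝ :=
  (ContinuousAlternatingMap.ofSubsingleton ℝ (TangentSpace 𝓘(ℝ, E) x) ℝ (0 : Fin 1)).symm (α x)

lemma Form.toCLM_apply (α : Form E M 1) (x : M) (v : TangentSpace 𝓘(ℝ, E) x) :
    α.toCLM x v = α x ![v] := by
  change α x (fun _ => v) = _
  congr 1
  ext i
  fin_cases i
  rfl

variable [IsManifold 𝓘(ℝ, E) ∞ M]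

/-- The pullback of a form along `c : P → M` near a point, computed in a chart of `M`. -/
lemma Form.pullback_eq_inChart {k : ℕ} (α : Form E M k) {c : P → M} {q : P} (x₀ : M)
    (hc : MDifferentiableAt 𝓘(ℝ, P) 𝓘(ℝ, E) c q)
    (hq : c q ∈ (extChartAt 𝓘(ℝ, E) x₀).source) :
    (α.pullback c q : P [⋀^Fin k]→L[ℝ] ℝ) =
      (α.inChart x₀ (extChartAt 𝓘(ℝ, E) x₀ (c q))).compContinuousLinearMap
        (fderiv ℝ (extChartAt 𝓘(ℝ, E) x₀ ∘ c) q) := by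
  have hq' : c q ∈ (chartAt E x₀).source := by rwa [extChartAt_source] at hq
  have hψ : MDifferentiableAt 𝓘(ℝ, E) 𝓘(ℝ, E) (extChartAt 𝓘(ℝ, E) x₀) (c q) :=
    mdifferentiableAt_extChartAt hq'
  have hψs : MDifferentiableAt 𝓘(ℝ, E) 𝓘(ℝ, E) (extChartAt 𝓘(ℝ, E) x₀).symm
      (extChartAt 𝓘(ℝ, E) x₀ (c q)) := by
    have := mdifferentiableWithinAt_extChartAt_symm (I := 𝓘(ℝ, E)) (x := x₀)
      ((extChartAt 𝓘(ℝ, E) x₀).map_source hq)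
    rwa [show range 𝓘(ℝ, E) = univ from ModelWithCorners.range_eq_univ _,
      mdifferentiableWithinAt_univ] at this
  have hcomp : mfderiv 𝓘(ℝ, P) 𝓘(ℝ, E) c q =
      (mfderiv 𝓘(ℝ, E) 𝓘(ℝ, E) (extChartAt 𝓘(ℝ, E) x₀).symm
        (extChartAt 𝓘(ℝ, E) x₀ (c q))).comp (fderiv ℝ (extChartAt 𝓘(ℝ, E) x₀ ∘ c) q) := by
    have h1 : c =ᶠ[𝓝 q] (extChartAt 𝓘(ℝ, E) x₀).symm ∘ (extChartAt 𝓘(ℝ, E) x₀ ∘ c) := by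
      have : ∀ᶠ p in 𝓝 q, c p ∈ (extChartAt 𝓘(ℝ, E) x₀).source :=
        hc.continuousAt.eventually ((isOpen_extChartAt_source x₀).mem_nhds hq)
      filter_upwards [this] with p hp
      exact ((extChartAt 𝓘(ℝ, E) x₀).left_inv hp).symm
    rw [h1.mfderiv_eq, mfderiv_comp q hψs (hψ.comp q hc), mfderiv_eq_fderiv]
    rfl
  have key : ∀ y : M, y = c q → ∀ v : Fin k → E,
      (α y : E [⋀^Fin k]→L[ℝ] ℝ) v = (α (c q) : E [⋀^Fin k]→L[ℝ] ℝ) v := by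
    rintro y rfl v; rfl
  ext v
  simp only [Form.pullback, Form.inChart]
  rw [hcomp]
  exact (key _ ((extChartAt 𝓘(ℝ, E) x₀).left_inv hq) _).symm

lemma contDiffOn_extChartAt_comp {c : P → M} {W : Set P} (hW : IsOpen W)
    (hc : ContMDiffOn 𝓘(ℝ, P) 𝓘(ℝ, E) ∞ c W) (x₀ : M) :
    IsOpen (W ∩ c ⁻¹' (extChartAt 𝓘(ℝ, E) x₀).source) ∧
      ContDiffOn ℝ ∞ (extChartAt 𝓘(ℝ, E) x₀ ∘ c)
        (W ∩ c ⁻¹' (extChartAt 𝓘(ℝ, E) x₀).source) := by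
  refine ⟨hc.continuousOn.isOpen_inter_preimage hW (isOpen_extChartAt_source _), ?_⟩
  rw [← contMDiffOn_iff_contDiffOn]
  refine (contMDiffOn_extChartAt (I := 𝓘(ℝ, E)) (x := x₀)).comp (hc.mono inter_subset_left) ?_
  intro q hq
  have := hq.2
  rwa [mem_preimage, extChartAt_source] at this

/-- Smoothness of the functions obtained by evaluating a smooth `1`-form on the partial
derivatives of a smooth map. -/
lemma Form.IsSmooth.contDiffOn_apply_mfderiv {α : Form E M 1} (hα : α.IsSmooth)
    {c : P → M} {W : Set P} (hW : IsOpen W) (hc : ContMDiffOn 𝓘(ℝ, P) 𝓘(ℝ, E) ∞ c W) (v : P) :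
    ContDiffOn ℝ ∞ (fun q => α (c q) ![mfderiv 𝓘(ℝ, P) 𝓘(ℝ, E) c q v]) W := by
  intro p hp
  set ψ := extChartAt 𝓘(ℝ, E) (c p) with hψ
  set W' : Set P := W ∩ c ⁻¹' ψ.source with hW'
  obtain ⟨hW'o, hcW⟩ : IsOpen W' ∧ ContDiffOn ℝ ∞ (ψ ∘ c) W' :=
    contDiffOn_extChartAt_comp hW hc (c p)
  have hpW' : p ∈ W' := ⟨hp, mem_extChartAt_source _⟩
  have h1 : ContDiffOn ℝ ∞ (fun q => (ContinuousAlternatingMap.ofSubsingletonLIE (𝕜 := ℝ) (E := E) (F := ℝ)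
      (0 : Fin 1)).symm (α.inChart (c p) (ψ (c q)))) W' := by
    refine (LinearIsometryEquiv.contDiff _).comp_contDiffOn ?_
    exact (hα (c p)).comp hcW fun q hq => ψ.map_source hq.2
  have h2 : ContDiffOn ℝ ∞ (fun q => fderiv ℝ (ψ ∘ c) q v) W' :=
    (hcW.fderiv_of_isOpen hW'o (by simp)).clm_apply contDiffOn_const
  have h3 := (h1.clm_apply h2).contDiffAt (hW'o.mem_nhds hpW')
  refine (h3.congr_of_eventuallyEq ?_).contDiffWithinAt
  filter_upwards [hW'o.mem_nhds hpW'] with q hq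
  have hcq : MDifferentiableAt 𝓘(ℝ, P) 𝓘(ℝ, E) c q :=
    (hc.contMDiffAt (hW.mem_nhds hq.1)).mdifferentiableAt (by simp)
  have := congrArg (fun β : P [⋀^Fin 1]→L[ℝ] ℝ => β (fun _ => v))
    (α.pullback_eq_inChart (c p) hcq hq.2)
  rw [← Form.toCLM_apply]
  exact this

/-- The formula `∂_v (α(∂_w c)) - ∂_w (α(∂_v c)) = dα(∂_v c, ∂_w c)` for a smooth map `c` from a
vector space: naturality of the exterior derivative, evaluated on constant vector fields. -/
lemma Form.IsSmooth.d_apply_mfderiv {α : Form E M 1} (hα : α.IsSmooth)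
    {c : P → M} {W : Set P} (hW : IsOpen W) (hc : ContMDiffOn 𝓘(ℝ, P) 𝓘(ℝ, E) ∞ c W)
    {p : P} (hp : p ∈ W) (v w : P) :
    α.d (c p) ![mfderiv 𝓘(ℝ, P) 𝓘(ℝ, E) c p v, mfderiv 𝓘(ℝ, P) 𝓘(ℝ, E) c p w] =
      fderiv ℝ (fun q => α (c q) ![mfderiv 𝓘(ℝ, P) 𝓘(ℝ, E) c q w]) p v -
        fderiv ℝ (fun q => α (c q) ![mfderiv 𝓘(ℝ, P) 𝓘(ℝ, E) c q v]) p w := by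
  set ψ := extChartAt 𝓘(ℝ, E) (c p) with hψ
  set W' : Set P := W ∩ c ⁻¹' ψ.source with hW'
  obtain ⟨hW'o, hcW⟩ : IsOpen W' ∧ ContDiffOn ℝ ∞ (ψ ∘ c) W' :=
    contDiffOn_extChartAt_comp hW hc (c p)
  have hpW' : p ∈ W' := ⟨hp, mem_extChartAt_source _⟩
  have hcp := hcW.contDiffAt (hW'o.mem_nhds hpW')
  have hmd : ∀ q ∈ W, MDifferentiableAt 𝓘(ℝ, P) 𝓘(ℝ, E) c q := fun q hq =>
    (hc.contMDiffAt (hW.mem_nhds hq)).mdifferentiableAt (by simp)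
  have htarget : ψ.target ∈ 𝓝 (ψ (c p)) :=
    (isOpen_extChartAt_target _).mem_nhds (ψ.map_source (mem_extChartAt_source _))
  have hω : DifferentiableAt ℝ (α.inChart (c p)) ((ψ ∘ c) p) :=
    ((hα (c p)).contDiffAt htarget).differentiableAt (by simp)
  set γ : P → P [⋀^Fin 1]→L[ℝ] ℝ := fun q =>
    (α.inChart (c p) ((ψ ∘ c) q)).compContinuousLinearMap (fderiv ℝ (ψ ∘ c) q) with hγ
  have hpull := extDeriv_pullback (r := ∞) hω hcp
    (by rw [minSmoothness_of_isRCLikeNormedField]; exact ENat.LEInfty.out)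
  have hγd : DifferentiableAt ℝ γ p := by
    refine DifferentiableAt.continuousAlternatingMapCompContinuousLinearMap ?_ ?_
    · exact hω.comp p (hcp.differentiableAt (by simp))
    · exact ((hcW.fderiv_of_isOpen (m := ∞) hW'o (by simp)).contDiffAt
        (hW'o.mem_nhds hpW')).differentiableAt (by simp)
  have hev : ∀ u : P, (fun q => α (c q) ![mfderiv 𝓘(ℝ, P) 𝓘(ℝ, E) c q u]) =ᶠ[𝓝 p]
      fun q => γ q (fun _ => u) := by
    intro u
    filter_upwards [hW'o.mem_nhds hpW'] with q hq
    have := congrArg (fun β : P [⋀^Fin 1]→L[ℝ] ℝ => β (fun _ => u))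
      (α.pullback_eq_inChart (c p) (hmd q hq.1) hq.2)
    rw [← Form.toCLM_apply]
    exact this
  rw [(hev v).fderiv_eq, (hev w).fderiv_eq]
  have hψd : MDifferentiableAt 𝓘(ℝ, E) 𝓘(ℝ, E) ψ (c p) :=
    mdifferentiableAt_extChartAt (mem_chart_source _ _)
  have hchain : ∀ u : P, fderiv ℝ (ψ ∘ c) p u =
      mfderiv 𝓘(ℝ, E) 𝓘(ℝ, E) ψ (c p) (mfderiv 𝓘(ℝ, P) 𝓘(ℝ, E) c p u) := by
    intro u
    rw [← mfderiv_eq_fderiv, mfderiv_comp p hψd (hmd p hp)]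
    rfl
  have h1 := congrArg (fun β : P [⋀^Fin 2]→L[ℝ] ℝ => β ![v, w]) hpull
  have h2 := extDeriv_apply hγd ![v, w]
  rw [Fin.sum_univ_two] at h2
  have e0 : (0 : Fin 2).removeNth ![v, w] = fun _ => w := by
    ext i; fin_cases i; rfl
  have e1 : (1 : Fin 2).removeNth ![v, w] = fun _ => v := by
    ext i; fin_cases i; rfl
  rw [e0, e1] at h2
  change extDeriv γ p ![v, w] = (-1) ^ 0 • fderiv ℝ (fun q => γ q fun _ => w) p v +
    (-1) ^ 1 • fderiv ℝ (fun q => γ q fun _ => v) p w at h2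
  rw [pow_zero, pow_one, one_smul, neg_one_smul] at h2
  change extDeriv γ p ![v, w] = _ at h1
  rw [h2] at h1
  rw [sub_eq_add_neg, h1]
  have e2 : (fderiv ℝ (ψ ∘ c) p : P → E) ∘ ![v, w] = ![fderiv ℝ (ψ ∘ c) p v, fderiv ℝ (ψ ∘ c) p w] := by
    ext i; fin_cases i <;> rfl
  change _ = extDeriv (α.inChart (c p)) ((ψ ∘ c) p) ((fderiv ℝ (ψ ∘ c) p : P → E) ∘ ![v, w])
  rw [e2, hchain, hchain]
  change extDeriv (α.inChart (c p)) ((ψ ∘ c) p) _ = _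
  congr 1
  ext i; fin_cases i <;> rfl

end FormCalculus

/-! ### Integrals depending smoothly on parameters -/

section ParametricIntegral

variable {F : Type*} [NormedAddCommGroup F] [NormedSpace ℝ F]

open MeasureTheory in
/-- Smoothness of `(t, y) ↦ ∫ s in 0..t, k (s, y)`. After the substitution `s = t u` this is an
integral over the fixed interval `[0, 1]`, that is the value at `0` of the convolution of the
indicator function of `[0, 1]` with a smooth function of compact support depending on the
parameters `(t, y)`. -/
lemma contDiffOn_primitive {k : ℝ × F → ℝ} {a : ℝ} {V : Set F} (hV : IsOpen V)
    (hk : ContDiffOn ℝ ∞ k (Ioo (-a) a ×ˢ V)) :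
    ContDiffOn ℝ ∞ (fun p : ℝ × F => ∫ s in (0 : ℝ)..p.1, k (s, p.2))
      (Ioo (-(a / 3)) (a / 3) ×ˢ V) := by
  -- a cutoff equal to `1` on `[-1, 1]` and supported in `[-2, 2]`
  let χ : ContDiffBump (0 : ℝ) := ⟨1, 2, one_pos, one_lt_two⟩
  set S : Set (ℝ × F) := Ioo (-(a / 3)) (a / 3) ×ˢ V with hS
  have hSo : IsOpen S := isOpen_Ioo.prod hV
  let g : ℝ × F → ℝ → ℝ := fun p u => χ u * k (-(p.1 * u), p.2)
  have hg : ContDiffOn ℝ ∞ (Function.uncurry g) (S ×ˢ univ) := by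
    rintro ⟨⟨t, y⟩, u⟩ ⟨⟨ht, hy⟩, -⟩
    by_cases hu : |u| < 3
    · have h1 : ContDiffAt ℝ ∞ k (-(t * u), y) := by
        refine hk.contDiffAt ((isOpen_Ioo.prod hV).mem_nhds ⟨?_, hy⟩)
        simp only [mem_Ioo] at ht ⊢
        have htu : |t * u| < a := by
          rw [abs_mul]
          have : |t| < a / 3 := abs_lt.2 ht
          nlinarith [abs_nonneg t, abs_nonneg u]
        have := abs_lt.1 htu
        constructor <;> linarith
      have h2 : ContDiffAt ℝ ∞ (fun q : (ℝ × F) × ℝ => (-(q.1.1 * q.2), q.1.2)) ((t, y), u) := by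
        fun_prop
      have h3 : ContDiffAt ℝ ∞ (fun q : (ℝ × F) × ℝ => χ q.2) ((t, y), u) :=
        χ.contDiff.contDiffAt.comp _ contDiffAt_snd
      exact (h3.mul (ContDiffAt.comp ((t, y), u) h1 h2)).contDiffWithinAt
    · refine (ContDiffAt.congr_of_eventuallyEq (f := fun _ => (0 : ℝ)) contDiffAt_const
        ?_).contDiffWithinAt
      have : ∀ᶠ q : (ℝ × F) × ℝ in 𝓝 ((t, y), u), 2 < |q.2| :=
        (continuous_abs.comp continuous_snd).continuousAt.eventually
          (lt_mem_nhds (by simp only [Function.comp]; linarith [not_lt.1 hu]))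
      filter_upwards [this] with q hq
      simp only [Function.uncurry, g]
      rw [χ.zero_of_le_dist (by rw [Real.dist_0_eq_abs]; exact hq.le), zero_mul]
  have hconv := contDiffOn_convolution_right_with_param_comp (μ := (volume : Measure ℝ)) (n := ⊤)
    (ContinuousLinearMap.mul ℝ ℝ) (s := S) (v := fun _ => (0 : ℝ)) contDiffOn_const
    (f := (Icc (0 : ℝ) 1).indicator fun _ => (1 : ℝ)) (g := g)
    (k := Metric.closedBall 0 2) hSo (isCompact_closedBall 0 2)
    (by
      intro p u _ hu
      simp only [g]
      rw [χ.zero_of_le_dist (by simpa using (not_le.1 (fun h => hu (Metric.mem_closedBall.2 h))).le),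
        zero_mul])
    (by
      refine Integrable.locallyIntegrable ?_
      exact (integrable_indicator_iff measurableSet_Icc).2 (integrableOn_const (by simp)))
    hg
  refine (contDiffOn_fst.mul hconv).congr ?_
  rintro ⟨t, y⟩ -
  have h1 : ∀ u : ℝ, (ContinuousLinearMap.mul ℝ ℝ) ((Icc (0 : ℝ) 1).indicator (fun _ => (1 : ℝ)) u)
      (g (t, y) (0 - u)) = (Icc (0 : ℝ) 1).indicator (fun u => k (t * u, y)) u := by
    intro u
    by_cases hu : u ∈ Icc (0 : ℝ) 1
    · have : χ (-u) = 1 := χ.one_of_mem_closedBall (by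
        simp only [Metric.mem_closedBall, dist_zero_right, Real.norm_eq_abs, abs_neg]
        rw [abs_of_nonneg hu.1]; exact hu.2)
      simp [indicator_of_mem hu, g, this]
    · simp [indicator_of_notMem hu]
  simp only [convolution, h1]
  rw [integral_indicator measurableSet_Icc, integral_Icc_eq_integral_Ioc,
    ← intervalIntegral.integral_of_le zero_le_one]
  have := intervalIntegral.smul_integral_comp_mul_left (a := 0) (b := 1) (fun s => k (s, y)) t
  simpa using this.symm

lemma hasDerivAt_primitive {k : ℝ × F → ℝ} {a : ℝ} {V : Set F}
    (hk : ContDiffOn ℝ ∞ k (Ioo (-a) a ×ˢ V)) {t : ℝ} (ht : t ∈ Ioo (-a) a) {y : F} (hy : y ∈ V) :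
    HasDerivAt (fun t => ∫ s in (0 : ℝ)..t, k (s, y)) (k (t, y)) t := by
  have hc : ContinuousOn (fun s => k (s, y)) (Ioo (-a) a) :=
    hk.continuousOn.comp (by fun_prop) fun s hs => ⟨hs, hy⟩
  have h0 : (0 : ℝ) ∈ Ioo (-a) a := by
    have := ht.1.trans ht.2
    constructor <;> linarith
  refine intervalIntegral.integral_hasDerivAt_right ?_ ?_
    (hc.continuousAt (isOpen_Ioo.mem_nhds ht))
  · exact (hc.mono ((ordConnected_Ioo).uIcc_subset h0 ht)).intervalIntegrable
  · exact hc.stronglyMeasurableAtFilter isOpen_Ioo t ht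

end ParametricIntegral

/-! ### Smooth flows and circle actions -/

section Flows

variable {E : Type*} [NormedAddCommGroup E] [NormedSpace ℝ E]
  {M : Type*} [TopologicalSpace M] [ChartedSpace E M]

/-- `Φ` is a smooth global flow of the vector field `Y`. -/
structure IsFlow (Φ : ℝ × M → M) (Y : VectorField E M) : Prop where
  smooth : ContMDiff (𝓘(ℝ, ℝ).prod 𝓘(ℝ, E)) 𝓘(ℝ, E) ∞ Φ
  zero : ∀ x, Φ (0, x) = x
  add : ∀ s t x, Φ (s + t, x) = Φ (s, Φ (t, x))
  integralCurve : ∀ x, IsMIntegralCurve (I := 𝓘(ℝ, E)) (fun t => Φ (t, x)) Y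

/-- The vector field `Y` has near `x₀` a smooth local flow, defined for times in `(-ε, ε)`. -/
def HasLocalFlow (Y : VectorField E M) (ε : ℝ) (x₀ : M) : Prop :=
  ∃ W : Set M, IsOpen W ∧ x₀ ∈ W ∧ ∃ φ : ℝ × M → M,
    ContMDiffOn (𝓘(ℝ, ℝ).prod 𝓘(ℝ, E)) 𝓘(ℝ, E) ∞ φ (Ioo (-ε) ε ×ˢ W) ∧
    (∀ x ∈ W, φ (0, x) = x) ∧
    ∀ x ∈ W, IsMIntegralCurveOn (I := 𝓘(ℝ, E)) (fun t => φ (t, x)) Y (Ioo (-ε) ε)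

lemma HasLocalFlow.mono {Y : VectorField E M} {ε ε' : ℝ} {x₀ : M} (h : HasLocalFlow Y ε x₀)
    (hε : ε' ≤ ε) : HasLocalFlow Y ε' x₀ := by
  obtain ⟨W, hW, hx₀, φ, hφ, hφ0, hφY⟩ := h
  have hsub : Ioo (-ε') ε' ⊆ Ioo (-ε) ε := Ioo_subset_Ioo (neg_le_neg hε) hε
  exact ⟨W, hW, hx₀, φ, hφ.mono (prod_mono_left hsub), hφ0, fun x hx => (hφY x hx).mono hsub⟩

variable [IsManifold 𝓘(ℝ, E) ∞ M]

/-- A vector field is smooth near a point if it is the velocity at time `0` of a smooth local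
flow. -/
lemma contMDiffOn_vectorField_of_localFlow {Y : VectorField E M} {ε : ℝ} (hε : 0 < ε) {W : Set M}
    (hW : IsOpen W) {φ : ℝ × M → M}
    (hφ : ContMDiffOn (𝓘(ℝ, ℝ).prod 𝓘(ℝ, E)) 𝓘(ℝ, E) ∞ φ (Ioo (-ε) ε ×ˢ W))
    (hφ0 : ∀ x ∈ W, φ (0, x) = x)
    (hφY : ∀ x ∈ W, IsMIntegralCurveOn (I := 𝓘(ℝ, E)) (fun t => φ (t, x)) Y (Ioo (-ε) ε)) :
    ContMDiffOn 𝓘(ℝ, E) 𝓘(ℝ, E).tangent 1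
      (fun x => (⟨x, Y x⟩ : TangentBundle 𝓘(ℝ, E) M)) W := by
  set S : Set (ℝ × M) := Ioo (-ε) ε ×ˢ W with hS
  have hSo : IsOpen S := isOpen_Ioo.prod hW
  have h0 : (0 : ℝ) ∈ Ioo (-ε) ε := ⟨by linarith, hε⟩
  -- the vector field `∂/∂t` along the slice `{0} × M`
  let s : M → TangentBundle (𝓘(ℝ, ℝ).prod 𝓘(ℝ, E)) (ℝ × M) := fun x =>
    (equivTangentBundleProd 𝓘(ℝ, ℝ) ℝ 𝓘(ℝ, E) M).symm
      ((⟨0, (1 : ℝ)⟩ : TangentBundle 𝓘(ℝ, ℝ) ℝ), Bundle.zeroSection E (TangentSpace 𝓘(ℝ, E)) x)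
  have hs : ContMDiff 𝓘(ℝ, E) (𝓘(ℝ, ℝ).prod 𝓘(ℝ, E)).tangent 1 s := by
    refine (contMDiff_equivTangentBundleProd_symm (n := 1)).comp ?_
    exact contMDiff_const.prodMk (Bundle.contMDiff_zeroSection ℝ _)
  have hT := hφ.contMDiffOn_tangentMapWithin (m := 1)
    (by rw [one_add_one_eq_two]; exact ENat.LEInfty.out) hSo.uniqueMDiffOn
  refine (hT.comp hs.contMDiffOn fun x hx => ⟨h0, hx⟩).congr ?_
  intro x hx
  have hmem : ((0 : ℝ), x) ∈ S := ⟨h0, hx⟩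
  have hd : MDifferentiableAt (𝓘(ℝ, ℝ).prod 𝓘(ℝ, E)) 𝓘(ℝ, E) φ ((0 : ℝ), x) :=
    (hφ.contMDiffAt (hSo.mem_nhds hmem)).mdifferentiableAt (by simp)
  have hv : mfderiv (𝓘(ℝ, ℝ).prod 𝓘(ℝ, E)) 𝓘(ℝ, E) φ ((0 : ℝ), x) ((1 : ℝ), (0 : E)) =
      Y (φ (0, x)) := by
    have hi := ((hφY x hx) 0 h0).hasMFDerivAt (isOpen_Ioo.mem_nhds h0)
    have := mfderiv_prod_eq_add_apply (v := ((1 : ℝ), (0 : E))) hd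
    rw [this]
    simp only [hi.mfderiv]
    erw [map_zero, add_zero]
    exact one_smul ℝ _
  have h1 : (⟨φ (0, x), mfderivWithin (𝓘(ℝ, ℝ).prod 𝓘(ℝ, E)) 𝓘(ℝ, E) φ S ((0 : ℝ), x)
      ((1 : ℝ), (0 : E))⟩ : TangentBundle 𝓘(ℝ, E) M) = ⟨x, Y x⟩ := by
    rw [mfderivWithin_of_isOpen hSo hmem, hv, hφ0 x hx]
  exact h1.symm

variable [T2Space M]

/-- Integral curves of a vector field with a smooth flow are orbits of the flow. -/
lemma IsFlow.eq_of_isMIntegralCurve [CompleteSpace E] {Φ : ℝ × M → M} {Y : VectorField E M}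
    (hΦ : IsFlow Φ Y) {c : ℝ → M} (hc : IsMIntegralCurve (I := 𝓘(ℝ, E)) c Y) (t : ℝ) :
    c t = Φ (t, c 0) := by
  have hY : ContMDiff 𝓘(ℝ, E) 𝓘(ℝ, E).tangent 1
      (fun x => (⟨x, Y x⟩ : TangentBundle 𝓘(ℝ, E) M)) :=
    contMDiffOn_univ.1 (contMDiffOn_vectorField_of_localFlow one_pos isOpen_univ
      hΦ.smooth.contMDiffOn (fun x _ => hΦ.zero x)
      fun x _ => (hΦ.integralCurve x).isMIntegralCurveOn _)
  exact congrFun (isMIntegralCurve_Ioo_eq_of_contMDiff_boundaryless (t₀ := 0) hY hc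
    (hΦ.integralCurve (c 0)) (hΦ.zero _).symm) t

/-- A vector field with smooth local flows whose times of existence are bounded below by a
positive constant has a smooth global flow. -/
theorem exists_isFlow_of_localFlow [CompleteSpace E] {Y : VectorField E M} {ε : ℝ} (hε : 0 < ε)
    (hloc : ∀ x₀ : M, HasLocalFlow Y ε x₀) :
    ∃ Φ : ℝ × M → M, IsFlow Φ Y := by
  have h0 : (0 : ℝ) ∈ Ioo (-ε) ε := ⟨by linarith, hε⟩
  have hY : ContMDiff 𝓘(ℝ, E) 𝓘(ℝ, E).tangent 1
      (fun x => (⟨x, Y x⟩ : TangentBundle 𝓘(ℝ, E) M)) := by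
    intro x
    obtain ⟨W, hW, hxW, φ, hφ, hφ0, hφY⟩ := hloc x
    exact (contMDiffOn_vectorField_of_localFlow hε hW hφ hφ0 hφY).contMDiffAt (hW.mem_nhds hxW)
  have hglob : ∀ x : M, ∃ γ : ℝ → M, γ 0 = x ∧ IsMIntegralCurve (I := 𝓘(ℝ, E)) γ Y := by
    refine exists_isMIntegralCurve_of_isMIntegralCurveOn hY hε fun x => ?_
    obtain ⟨W, hW, hxW, φ, hφ, hφ0, hφY⟩ := hloc x
    exact ⟨fun t => φ (t, x), hφ0 x hxW, hφY x hxW⟩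
  choose γ hγ0 hγY using hglob
  have huniq : ∀ c : ℝ → M, IsMIntegralCurve (I := 𝓘(ℝ, E)) c Y → ∀ t, c t = γ (c 0) t := by
    intro c hc t
    have := isMIntegralCurve_Ioo_eq_of_contMDiff_boundaryless (t₀ := 0) hY hc (hγY (c 0))
      (hγ0 _).symm
    exact congrFun this t
  set Φ : ℝ × M → M := fun p => γ p.2 p.1 with hΦ
  have hadd : ∀ s t x, Φ (s + t, x) = Φ (s, Φ (t, x)) := by
    intro s t x
    have := huniq _ ((hγY x).comp_add t) s
    simpa [hΦ, Function.comp] using this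
  have hloc' : ContMDiffOn (𝓘(ℝ, ℝ).prod 𝓘(ℝ, E)) 𝓘(ℝ, E) ∞ Φ (Ioo (-ε) ε ×ˢ univ) := by
    rintro ⟨t, x⟩ ⟨ht, -⟩
    obtain ⟨W, hW, hxW, φ, hφ, hφ0, hφY⟩ := hloc x
    have hnhds : Ioo (-ε) ε ×ˢ W ∈ 𝓝 (t, x) := (isOpen_Ioo.prod hW).mem_nhds ⟨ht, hxW⟩
    refine ((hφ.contMDiffAt hnhds).congr_of_eventuallyEq ?_).contMDiffWithinAt
    filter_upwards [hnhds] with p hp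
    have := isMIntegralCurveOn_Ioo_eqOn_of_contMDiff_boundaryless h0 hY
      ((hγY p.2).isMIntegralCurveOn _) (hφY p.2 hp.2) (by rw [hγ0, hφ0 _ hp.2])
    exact this hp.1
  have hstep : ∀ t ∈ Ioo (-ε) ε, ∀ n : ℕ,
      ContMDiff 𝓘(ℝ, E) 𝓘(ℝ, E) ∞ (fun x => Φ (n * t, x)) := by
    intro t ht n
    induction n with
    | zero =>
      refine contMDiff_id.congr fun x => ?_
      simp [hΦ, hγ0]
    | succ n ih =>
      have h1 : ContMDiff 𝓘(ℝ, E) 𝓘(ℝ, E) ∞ (fun x => Φ (t, x)) := fun x =>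
        (hloc'.contMDiffAt ((isOpen_Ioo.prod isOpen_univ).mem_nhds ⟨ht, mem_univ x⟩)).comp x
          (contMDiffAt_const.prodMk contMDiffAt_id)
      refine (ih.comp h1).congr fun x => ?_
      rw [Function.comp, ← hadd]
      congr 2
      push_cast; ring
  have htime : ∀ t : ℝ, ContMDiff 𝓘(ℝ, E) 𝓘(ℝ, E) ∞ (fun x => Φ (t, x)) := by
    intro t
    obtain ⟨n, hn⟩ := exists_nat_gt (|t| / ε)
    have hn0 : (0 : ℝ) < n := (div_nonneg (abs_nonneg t) hε.le).trans_lt hn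
    have ht : t / n ∈ Ioo (-ε) ε := by
      rw [mem_Ioo, ← abs_lt, abs_div, abs_of_pos hn0, div_lt_iff₀ hn0, mul_comm]
      exact (div_lt_iff₀ hε).1 hn
    have := hstep _ ht n
    rwa [mul_div_cancel₀ _ hn0.ne'] at this
  refine ⟨Φ, ?_, hγ0, hadd, hγY⟩
  rintro ⟨t₀, x₀⟩
  have h1 : ContMDiffAt (𝓘(ℝ, ℝ).prod 𝓘(ℝ, E)) 𝓘(ℝ, E) ∞
      (fun p : ℝ × M => Φ (p.1 - t₀, p.2)) (t₀, x₀) := by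
    refine ContMDiffAt.comp (t₀, x₀) (g := Φ) (f := fun p : ℝ × M => (p.1 - t₀, p.2))
      (hloc'.contMDiffAt ((isOpen_Ioo.prod isOpen_univ).mem_nhds ⟨?_, mem_univ x₀⟩)) ?_
    · simpa using h0
    · exact (contMDiffAt_fst.sub contMDiffAt_const).prodMk contMDiffAt_snd
  refine (((htime t₀).contMDiffAt).comp (t₀, x₀) h1).congr_of_eventuallyEq
    (Eventually.of_forall fun p => ?_)
  rw [Function.comp, ← hadd]
  simp

end Flows

section Circle

lemma contMDiffOn_circle_arg :
    ContMDiffOn (𝓡 1) 𝓘(ℝ, ℝ) ∞ (fun z : Circle => Complex.arg z)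
      {z : Circle | (z : ℂ) ∈ Complex.slitPlane} := by
  intro z hz
  have : Fact (Module.finrank ℝ ℂ = 1 + 1) := ⟨by simp⟩
  have h1 : ContMDiff (𝓡 1) 𝓘(ℝ, ℂ) ∞ (fun z : Circle => (z : ℂ)) :=
    contMDiff_coe_sphere (E := ℂ)
  have h2 : ContDiffAt ℝ ∞ (fun w : ℂ => Complex.arg w) (z : ℂ) := by
    have : (fun w : ℂ => Complex.arg w) = fun w => Complex.imCLM (Complex.log w) := by
      ext w; simp [Complex.log_im]
    rw [this]
    exact Complex.imCLM.contDiff.contDiffAt.comp _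
      ((Complex.contDiffAt_log hz).restrict_scalars ℝ)
  exact (h2.contMDiffAt.comp z h1.contMDiffAt).contMDiffWithinAt

lemma isOpen_circle_slitPlane : IsOpen {z : Circle | (z : ℂ) ∈ Complex.slitPlane} :=
  Complex.isOpen_slitPlane.preimage continuous_subtype_val

variable {E : Type*} [NormedAddCommGroup E] [NormedSpace ℝ E]
  {M : Type*} [TopologicalSpace M] [ChartedSpace E M]

/-- A smooth flow of period `2π` factors through a smooth action `a` of the circle. It is smooth
because a point of the circle has an angle depending smoothly on it locally. -/
theorem IsFlow.exists_circleAction {Φ : ℝ × M → M} {Y : VectorField E M} (hΦ : IsFlow Φ Y)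
    (hper : ∀ x, Φ (2 * Real.pi, x) = x) :
    ∃ a : Circle → M → M, (∀ x, a 1 x = x) ∧ (∀ z w x, a (z * w) x = a z (a w x)) ∧
      ContMDiff ((𝓡 1).prod 𝓘(ℝ, E)) 𝓘(ℝ, E) ∞ (fun p : Circle × M => a p.1 p.2) ∧
      ∀ (t : ℝ) (x : M), a (Circle.exp t) x = Φ (t, x) := by
  have hint : ∀ (n : ℕ) (x : M), Φ (n * (2 * Real.pi), x) = x := by
    intro n x
    induction n with
    | zero => simpa using hΦ.zero x
    | succ n ih => rw [Nat.cast_succ, add_mul, one_mul, hΦ.add, hper, ih]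
  have hexp : ∀ s t : ℝ, Circle.exp s = Circle.exp t → ∀ x, Φ (s, x) = Φ (t, x) := by
    intro s t hst x
    obtain ⟨m, rfl⟩ := Circle.exp_eq_exp.1 hst
    rcases Int.eq_nat_or_neg m with ⟨n, rfl | rfl⟩
    · rw [hΦ.add]; simp [hint]
    · rw [← hint n (Φ (t + _, x)), ← hΦ.add]
      congr 2
      push_cast; ring
  refine ⟨fun z x => Φ (Complex.arg z, x), fun x => by simp [hΦ.zero], fun z w x => ?_, ?_,
    fun t x => hexp _ _ (Circle.exp_arg _) x⟩
  · refine Eq.trans ?_ (hΦ.add _ _ x)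
    refine hexp _ _ ?_ x
    rw [Circle.exp_arg, Circle.exp_add, Circle.exp_arg, Circle.exp_arg]
  rintro ⟨z₀, x₀⟩
  have hmem : z₀ * z₀⁻¹ ∈ {z : Circle | (z : ℂ) ∈ Complex.slitPlane} := by simp
  have hθ : ContMDiffAt ((𝓡 1).prod 𝓘(ℝ, E)) 𝓘(ℝ, ℝ) ∞
      (fun p : Circle × M => Complex.arg z₀ + Complex.arg ((p.1 * z₀⁻¹ : Circle) : ℂ))
      (z₀, x₀) := by
    refine contMDiffAt_const.add ?_
    refine ContMDiffAt.comp (z₀, x₀) (g := fun z : Circle => Complex.arg z)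
      (f := fun p : Circle × M => p.1 * z₀⁻¹)
      (contMDiffOn_circle_arg.contMDiffAt (isOpen_circle_slitPlane.mem_nhds hmem)) ?_
    exact contMDiffAt_fst.mul contMDiffAt_const
  refine (hΦ.smooth.contMDiffAt.comp (z₀, x₀)
    (hθ.prodMk contMDiffAt_snd)).congr_of_eventuallyEq (Eventually.of_forall fun p => ?_)
  refine hexp _ _ ?_ _
  rw [Circle.exp_add, Circle.exp_arg, Circle.exp_arg, Circle.exp_arg]
  simp

end Circle

/-! ### Principal circle bundles and connection forms -/

section Bundles

variable {E : Type*} [NormedAddCommGroup E] [NormedSpace ℝ E]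
  {M : Type*} [TopologicalSpace M] [ChartedSpace E M]
  {F : Type*} [NormedAddCommGroup F] [NormedSpace ℝ F]
  {B : Type*} [TopologicalSpace B] [ChartedSpace F B]
  {G : Type*} [NormedAddCommGroup G] [NormedSpace ℝ G]
  {P : Type*} [TopologicalSpace P] [ChartedSpace G P]
  [MulAction Circle M]

/-- A smooth section `σ` of a principal circle bundle over an open set `U`, together with the
angular coordinate `τ` it defines on `π⁻¹(U)`: `x = τ(x) • σ(π(x))`. -/
structure IsLocalSection (π : M → B) (U : Set B) (σ : B → M) (τ : M → Circle) : Prop where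
  isOpen : IsOpen U
  smooth_section : ContMDiffOn 𝓘(ℝ, F) 𝓘(ℝ, E) ∞ σ U
  smooth_angle : ContMDiffOn 𝓘(ℝ, E) (𝓡 1) ∞ τ (π ⁻¹' U)
  proj_section : ∀ b ∈ U, π (σ b) = b
  angle_smul : ∀ x ∈ π ⁻¹' U, ∀ z : Circle, τ (z • x) = z * τ x
  angle_smul_section : ∀ x ∈ π ⁻¹' U, τ x • σ (π x) = x

lemma IsPrincipalCircleBundle.exists_isLocalSection {π : M → B}
    (h : IsPrincipalCircleBundle (E := E) (F := F) π) (b₀ : B) :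
    ∃ (U : Set B) (σ : B → M) (τ : M → Circle), b₀ ∈ U ∧
      IsLocalSection (E := E) (F := F) π U σ τ := by
  obtain ⟨U, e, hU, hb₀, hes, het, he, hei, hx⟩ := h.locally_trivial b₀
  have hmem : ∀ b ∈ U, (b, (1 : Circle)) ∈ e.target := fun b hb => by
    rw [het]; exact ⟨hb, mem_univ _⟩
  have hσs : ∀ b ∈ U, e.symm (b, 1) ∈ e.source := fun b hb => e.map_target (hmem b hb)
  have hσπ : ∀ b ∈ U, π (e.symm (b, 1)) = b := fun b hb => by
    rw [← (hx _ (hσs b hb)).1, e.right_inv (hmem b hb)]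
  have hst : ∀ x ∈ π ⁻¹' U, ∀ z : Circle, z • x ∈ e.source := fun x hxU z => by
    rw [hes, mem_preimage, h.proj_smul]; exact hxU
  have hfst : ∀ x ∈ π ⁻¹' U, e x = (π x, (e x).2) := fun x hxU => by
    rw [← (hx x (hes ▸ hxU)).1]
  refine ⟨U, fun b => e.symm (b, 1), fun x => (e x).2, hb₀, hU, ?_, ?_, hσπ, ?_, ?_⟩
  · exact hei.comp (contMDiffOn_id.prodMk contMDiffOn_const) hmem
  · rw [← hes]
    exact contMDiff_snd.comp_contMDiffOn he
  · intro x hxU z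
    simp only [(hx x (hes ▸ hxU)).2 z]
  · intro x hxU
    have hb : π x ∈ U := hxU
    refine e.injOn (by rw [hes, mem_preimage, h.proj_smul, hσπ _ hb]; exact hb) (hes ▸ hxU) ?_
    rw [(hx _ (hσs _ hb)).2, hσπ _ hb, e.right_inv (hmem _ hb), mul_one]
    exact (hfst x hxU).symm

lemma IsPrincipalCircleBundle.eq_one_of_smul_eq {π : M → B}
    (h : IsPrincipalCircleBundle (E := E) (F := F) π) {z : Circle} {x : M} (hz : z • x = x) :
    z = 1 := by
  obtain ⟨U, σ, τ, hxU, hs⟩ := h.exists_isLocalSection (π x)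
  have := hs.angle_smul x hxU z
  rw [hz] at this
  exact right_eq_mul.1 this

section Product

lemma contMDiff_exp_smul [ContMDiffSMul (𝓡 1) 𝓘(ℝ, E) ∞ Circle M] :
    ContMDiff (𝓘(ℝ, ℝ).prod 𝓘(ℝ, E)) 𝓘(ℝ, E) ∞ (fun p : ℝ × M => Circle.exp p.1 • p.2) :=
  (contMDiff_smul (I := 𝓡 1) (I' := 𝓘(ℝ, E))).comp
    ((contMDiff_circleExp.comp contMDiff_fst).prodMk contMDiff_snd)

lemma contMDiff_circle_smul [ContMDiffSMul (𝓡 1) 𝓘(ℝ, E) ∞ Circle M] (z : Circle) :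
    ContMDiff 𝓘(ℝ, E) 𝓘(ℝ, E) ∞ (fun y : M => z • y) :=
  (contMDiff_smul (I := 𝓡 1) (I' := 𝓘(ℝ, E))).comp (contMDiff_const.prodMk contMDiff_id)

lemma IsPrincipalCircleBundle.mfderiv_surjective {π : M → B}
    (hπ : IsPrincipalCircleBundle (E := E) (F := F) π) (x : M) :
    Function.Surjective (mfderiv 𝓘(ℝ, E) 𝓘(ℝ, F) π x) := by
  have := hπ.smooth_action
  obtain ⟨U, σ, τ, hxU, hs⟩ := hπ.exists_isLocalSection (π x)
  have hxU' : π x ∈ U := hxU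
  have hx : τ x • σ (π x) = x := hs.angle_smul_section x hxU
  have hg : MDifferentiableAt 𝓘(ℝ, F) 𝓘(ℝ, E) (fun b => τ x • σ b) (π x) :=
    ((contMDiff_circle_smul (τ x)).contMDiffAt.comp (π x)
      (hs.smooth_section.contMDiffAt (hs.isOpen.mem_nhds hxU))).mdifferentiableAt (by simp)
  have hπd : MDifferentiableAt 𝓘(ℝ, E) 𝓘(ℝ, F) π x :=
    hπ.smooth_proj.contMDiffAt.mdifferentiableAt (by simp)
  have hid : π ∘ (fun b => τ x • σ b) =ᶠ[𝓝 (π x)] id := by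
    filter_upwards [hs.isOpen.mem_nhds hxU'] with b hb
    simp only [Function.comp, hπ.proj_smul, hs.proj_section b hb, id]
  have h1 := mfderiv_comp_of_eq (x := π x) hπd hg hx
  rw [hid.mfderiv_eq, mfderiv_id] at h1
  intro w
  refine ⟨mfderiv 𝓘(ℝ, F) 𝓘(ℝ, E) (fun b => τ x • σ b) (π x) w, ?_⟩
  have h2 := congrArg (fun L : F →L[ℝ] F => L w) h1
  have h3 : ∀ y : M, y = x → (mfderiv 𝓘(ℝ, E) 𝓘(ℝ, F) π y : E →L[ℝ] F) =
      mfderiv 𝓘(ℝ, E) 𝓘(ℝ, F) π x := by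
    rintro y rfl; rfl
  exact (congrArg (fun L : E →L[ℝ] F =>
    L (mfderiv 𝓘(ℝ, F) 𝓘(ℝ, E) (fun b => τ x • σ b) (π x) w)) (h3 _ hx).symm).trans h2.symm

lemma hasMFDerivAt_exp_smul [ContMDiffSMul (𝓡 1) 𝓘(ℝ, E) ∞ Circle M] (t : ℝ) (x : M) :
    HasMFDerivAt 𝓘(ℝ, ℝ) 𝓘(ℝ, E) (fun s : ℝ => Circle.exp s • x) t
      ((1 : ℝ →L[ℝ] ℝ).smulRight (fundamentalVectorField (Circle.exp t • x))) := by
  have hd : ∀ y : M, MDifferentiable 𝓘(ℝ, ℝ) 𝓘(ℝ, E) (fun s : ℝ => Circle.exp s • y) := fun y =>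
    ((contMDiff_exp_smul (E := E)).comp (contMDiff_id.prodMk contMDiff_const)).mdifferentiable
      (by simp)
  -- the curve through `x` at time `t` is a translate of the curve through `exp(it) • x` at time `0`
  have hshift : (fun s : ℝ => Circle.exp s • x) =
      (fun s : ℝ => Circle.exp s • (Circle.exp t • x)) ∘ fun s => s - t := by
    ext s
    rw [Function.comp, smul_smul, ← Circle.exp_add, sub_add_cancel]
  have h1 : HasMFDerivAt 𝓘(ℝ, ℝ) 𝓘(ℝ, ℝ) (fun s : ℝ => s - t) t (ContinuousLinearMap.id ℝ ℝ) :=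
    ((hasFDerivAt_id t).sub_const t).hasMFDerivAt
  have h2 := (hd (Circle.exp t • x) (t - t)).hasMFDerivAt
  have h3 := HasMFDerivAt.comp (f := fun s : ℝ => s - t) t h2 h1
  rw [← hshift] at h3
  refine h3.congr_mfderiv ?_
  ext
  simp only [fundamentalVectorField]
  have : ∀ s : ℝ, s = 0 → (mfderiv 𝓘(ℝ, ℝ) 𝓘(ℝ, E)
      (fun s : ℝ => Circle.exp s • (Circle.exp t • x)) 0 (1 : ℝ) : E) =
      (mfderiv 𝓘(ℝ, ℝ) 𝓘(ℝ, E) (fun s : ℝ => Circle.exp s • (Circle.exp t • x)) s (1 : ℝ) : E) := by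
    rintro s rfl; rfl
  exact (this (t - t) (sub_self t)).symm.trans (one_smul ℝ _).symm

/-- The Leibniz rule for `q ↦ exp(iθ(q)) • m(q)`. -/
lemma mfderiv_exp_smul [ContMDiffSMul (𝓡 1) 𝓘(ℝ, E) ∞ Circle M] {θ : P → ℝ} {m : P → M} {p : P}
    {θ' : TangentSpace 𝓘(ℝ, G) p →L[ℝ] ℝ} (hθ : HasMFDerivAt 𝓘(ℝ, G) 𝓘(ℝ, ℝ) θ p θ')
    (hm : MDifferentiableAt 𝓘(ℝ, G) 𝓘(ℝ, E) m p) (v : TangentSpace 𝓘(ℝ, G) p) :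
    mfderiv 𝓘(ℝ, G) 𝓘(ℝ, E) (fun q => Circle.exp (θ q) • m q) p v =
      θ' v • fundamentalVectorField (Circle.exp (θ p) • m p) +
        mfderiv 𝓘(ℝ, E) 𝓘(ℝ, E) (fun y : M => Circle.exp (θ p) • y) (m p)
          (mfderiv 𝓘(ℝ, G) 𝓘(ℝ, E) m p v) := by
  have ha : MDifferentiableAt (𝓘(ℝ, ℝ).prod 𝓘(ℝ, E)) 𝓘(ℝ, E)
      (fun p : ℝ × M => Circle.exp p.1 • p.2) (θ p, m p) :=
    (contMDiff_exp_smul (E := E)).contMDiffAt.mdifferentiableAt (by simp)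
  have h1 : mfderiv 𝓘(ℝ, G) 𝓘(ℝ, E) (fun q => Circle.exp (θ q) • m q) p =
      (mfderiv (𝓘(ℝ, ℝ).prod 𝓘(ℝ, E)) 𝓘(ℝ, E) (fun p : ℝ × M => Circle.exp p.1 • p.2)
        (θ p, m p)).comp (mfderiv 𝓘(ℝ, G) (𝓘(ℝ, ℝ).prod 𝓘(ℝ, E)) (fun q => (θ q, m q)) p) :=
    mfderiv_comp p ha (hθ.mdifferentiableAt.prodMk hm)
  rw [h1, mfderiv_prodMk hθ.mdifferentiableAt hm, hθ.mfderiv]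
  have h2 := fun u => mfderiv_prod_eq_add_apply (v := u) ha
  refine (h2 (θ' v, mfderiv 𝓘(ℝ, G) 𝓘(ℝ, E) m p v)).trans ?_
  simp only [(hasMFDerivAt_exp_smul (E := E) (θ p) (m p)).mfderiv]
  rfl

/-- A connection form evaluated on the derivative of `q ↦ exp(iθ(q)) • m(q)`. -/
lemma IsConnectionForm.apply_mfderiv_exp_smul [ContMDiffSMul (𝓡 1) 𝓘(ℝ, E) ∞ Circle M]
    {α : Form E M 1} (hα : IsConnectionForm α) {θ : P → ℝ} {m : P → M} {p : P}
    {θ' : TangentSpace 𝓘(ℝ, G) p →L[ℝ] ℝ} (hθ : HasMFDerivAt 𝓘(ℝ, G) 𝓘(ℝ, ℝ) θ p θ')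
    (hm : MDifferentiableAt 𝓘(ℝ, G) 𝓘(ℝ, E) m p) (v : TangentSpace 𝓘(ℝ, G) p) :
    α (Circle.exp (θ p) • m p)
      ![mfderiv 𝓘(ℝ, G) 𝓘(ℝ, E) (fun q => Circle.exp (θ q) • m q) p v] =
      θ' v + α (m p) ![mfderiv 𝓘(ℝ, G) 𝓘(ℝ, E) m p v] := by
  rw [mfderiv_exp_smul hθ hm v, ← Form.toCLM_apply, ← Form.toCLM_apply, map_add, map_smul]
  have h1 : α.toCLM (Circle.exp (θ p) • m p)
      (fundamentalVectorField (Circle.exp (θ p) • m p)) = 1 := by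
    rw [Form.toCLM_apply]; exact hα.normalised _
  rw [h1, smul_eq_mul, mul_one]
  congr 1
  exact congrArg (fun β : E [⋀^Fin 1]→L[ℝ] ℝ =>
    β (fun _ => mfderiv 𝓘(ℝ, G) 𝓘(ℝ, E) m p v)) (hα.invariant (Circle.exp (θ p)) (m p))

lemma IsConnectionForm.apply_mfderiv_smul [ContMDiffSMul (𝓡 1) 𝓘(ℝ, E) ∞ Circle M]
    {α : Form E M 1} (hα : IsConnectionForm α) (z : Circle) {m : P → M} {p : P}
    (hm : MDifferentiableAt 𝓘(ℝ, G) 𝓘(ℝ, E) m p) (v : TangentSpace 𝓘(ℝ, G) p) :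
    α (z • m p) ![mfderiv 𝓘(ℝ, G) 𝓘(ℝ, E) (fun q => z • m q) p v] =
      α (m p) ![mfderiv 𝓘(ℝ, G) 𝓘(ℝ, E) m p v] := by
  obtain ⟨t, rfl⟩ := Circle.exp_surjective z
  have := hα.apply_mfderiv_exp_smul (θ := fun _ => t) (hasMFDerivAt_const t p) hm v
  exact this.trans (zero_add _)

end Product

/-- The vertical tangent spaces of a principal circle bundle are spanned by the fundamental vector
field. -/
lemma eq_smul_fundamentalVectorField {π : M → B} {α : Form E M 1}
    (hπ : IsPrincipalCircleBundle (E := E) (F := F) π) (hα : IsConnectionForm α) {x : M}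
    {v : TangentSpace 𝓘(ℝ, E) x} (hv : mfderiv 𝓘(ℝ, E) 𝓘(ℝ, F) π x v = 0) :
    v = α x ![v] • fundamentalVectorField x := by
  have := hπ.smooth_action
  obtain ⟨U, σ, τ, hxU, hs⟩ := hπ.exists_isLocalSection (π x)
  have hUo : IsOpen (π ⁻¹' U) := hs.isOpen.preimage hπ.smooth_proj.continuous
  -- near `x` the identity map is `y ↦ exp(iθ(y)) • m(y)` with `m` factoring through `π`
  let θ : M → ℝ := fun y => Complex.arg ((τ y * (τ x)⁻¹ : Circle) : ℂ)
  let m : M → M := fun y => τ x • σ (π y)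
  have hid : (fun y => Circle.exp (θ y) • m y) =ᶠ[𝓝 x] id := by
    filter_upwards [hUo.mem_nhds hxU] with y hy
    simp only [θ, m, Circle.exp_arg, smul_smul, inv_mul_cancel_right]
    exact hs.angle_smul_section y hy
  have hθ : MDifferentiableAt 𝓘(ℝ, E) 𝓘(ℝ, ℝ) θ x := by
    have h1 : ContMDiffAt 𝓘(ℝ, E) (𝓡 1) ∞ (fun y => τ y * (τ x)⁻¹) x :=
      (hs.smooth_angle.contMDiffAt (hUo.mem_nhds hxU)).mul contMDiffAt_const
    have hmem : τ x * (τ x)⁻¹ ∈ {z : Circle | (z : ℂ) ∈ Complex.slitPlane} := by simp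
    exact ((contMDiffOn_circle_arg.contMDiffAt (isOpen_circle_slitPlane.mem_nhds hmem)).comp x
      h1).mdifferentiableAt (by simp)
  have hg : MDifferentiableAt 𝓘(ℝ, F) 𝓘(ℝ, E) (fun b => τ x • σ b) (π x) :=
    ((contMDiff_circle_smul (τ x)).contMDiffAt.comp (π x)
      (hs.smooth_section.contMDiffAt (hs.isOpen.mem_nhds hxU))).mdifferentiableAt (by simp)
  have hπd : MDifferentiableAt 𝓘(ℝ, E) 𝓘(ℝ, F) π x :=
    hπ.smooth_proj.contMDiffAt.mdifferentiableAt (by simp)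
  have hm : MDifferentiableAt 𝓘(ℝ, E) 𝓘(ℝ, E) m x := hg.comp x hπd
  have hmv : mfderiv 𝓘(ℝ, E) 𝓘(ℝ, E) m x v = 0 := by
    have : mfderiv 𝓘(ℝ, E) 𝓘(ℝ, E) m x = _ :=
      mfderiv_comp (g := fun b => τ x • σ b) x hg hπd
    rw [this]
    change mfderiv 𝓘(ℝ, F) 𝓘(ℝ, E) (fun b => τ x • σ b) (π x)
      (mfderiv 𝓘(ℝ, E) 𝓘(ℝ, F) π x v) = 0
    rw [hv, map_zero]
  obtain ⟨θ', hθ'⟩ : ∃ θ' : TangentSpace 𝓘(ℝ, E) x →L[ℝ] ℝ,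
      HasMFDerivAt 𝓘(ℝ, E) 𝓘(ℝ, ℝ) θ x θ' := ⟨_, hθ.hasMFDerivAt⟩
  have h1 := mfderiv_exp_smul hθ' hm v
  rw [hmv, map_zero, add_zero, hid.mfderiv_eq, mfderiv_id] at h1
  have hx' : Circle.exp (θ x) • m x = x := hid.eq_of_nhds
  obtain ⟨r, hr⟩ : ∃ r : ℝ, v = r • fundamentalVectorField x :=
    ⟨θ' v, h1.trans (by rw [hx'])⟩
  have h2 : α x ![v] = r := by
    rw [hr, ← Form.toCLM_apply, map_smul, Form.toCLM_apply, hα.normalised, smul_eq_mul, mul_one]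
  rw [h2, ← hr]

/-- A tangent vector of the total space is determined by its projection and its vertical part. -/
lemma eq_of_mfderiv_eq_of_apply_eq {π : M → B} {α : Form E M 1}
    (hπ : IsPrincipalCircleBundle (E := E) (F := F) π) (hα : IsConnectionForm α) {x : M}
    {v w : TangentSpace 𝓘(ℝ, E) x}
    (h1 : mfderiv 𝓘(ℝ, E) 𝓘(ℝ, F) π x v = mfderiv 𝓘(ℝ, E) 𝓘(ℝ, F) π x w)
    (h2 : α x ![v] = α x ![w]) : v = w := by
  have h3 := eq_smul_fundamentalVectorField hπ hα (x := x) (v := v - w)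
    (by rw [map_sub, h1, sub_self])
  rw [← Form.toCLM_apply, map_sub, Form.toCLM_apply, Form.toCLM_apply, h2, sub_self,
    zero_smul] at h3
  exact sub_eq_zero.1 h3

end Bundles

/-! ### The flow of a lifted vector field -/

section LiftedFlow

variable {E : Type*} [NormedAddCommGroup E] [NormedSpace ℝ E]
  {M : Type*} [TopologicalSpace M] [ChartedSpace E M]
  {F : Type*} [NormedAddCommGroup F] [NormedSpace ℝ F]
  {B : Type*} [TopologicalSpace B] [ChartedSpace F B]
  [MulAction Circle M]
  {π : M → B} {α : Form E M 1} {H : B → ℝ} {X : VectorField F B} {Y : VectorField E M}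

/-- `Y` is a lift of `X` along `π` whose vertical part is prescribed by `α(Y) = H ∘ π`. -/
structure IsLift (π : M → B) (α : Form E M 1) (H : B → ℝ) (X : VectorField F B)
    (Y : VectorField E M) : Prop where
  proj : ∀ x, mfderiv 𝓘(ℝ, E) 𝓘(ℝ, F) π x (Y x) = X (π x)
  vertical : ∀ x, α x ![Y x] = H (π x)

/-- A curve is tangent to the lift `Y` of `X` if its projection is tangent to `X` and its vertical
velocity is prescribed by `H`. -/
lemma IsLift.hasMFDerivAt (hπ : IsPrincipalCircleBundle (E := E) (F := F) π)
    (hα : IsConnectionForm α) (hY : IsLift π α H X Y) {c : ℝ → M} {t : ℝ}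
    (hc : MDifferentiableAt 𝓘(ℝ, ℝ) 𝓘(ℝ, E) c t)
    (hcX : HasMFDerivAt 𝓘(ℝ, ℝ) 𝓘(ℝ, F) (π ∘ c) t
      ((1 : ℝ →L[ℝ] ℝ).smulRight (X (π (c t)))))
    (hcα : α (c t) ![mfderiv 𝓘(ℝ, ℝ) 𝓘(ℝ, E) c t (1 : ℝ)] = H (π (c t))) :
    HasMFDerivAt 𝓘(ℝ, ℝ) 𝓘(ℝ, E) c t ((1 : ℝ →L[ℝ] ℝ).smulRight (Y (c t))) := by
  have hπd : MDifferentiableAt 𝓘(ℝ, E) 𝓘(ℝ, F) π (c t) :=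
    hπ.smooth_proj.contMDiffAt.mdifferentiableAt (by simp)
  have hv : mfderiv 𝓘(ℝ, ℝ) 𝓘(ℝ, E) c t (1 : ℝ) = Y (c t) := by
    refine eq_of_mfderiv_eq_of_apply_eq hπ hα ?_ (hcα.trans (hY.vertical _).symm)
    have h1 := hcX.mfderiv
    rw [mfderiv_comp t hπd hc] at h1
    have h2 := congrArg (fun L : ℝ →L[ℝ] F => L 1) h1
    exact h2.trans ((one_smul ℝ _).trans (hY.proj _).symm)
  refine hc.hasMFDerivAt.congr_mfderiv ?_
  ext
  exact hv.trans (one_smul ℝ _).symm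

/-- The local flows of the lift: in terms of a local section `σ`, they are given by
`z • σ(b) ↦ exp(ih(t, b)) • z • σ(ρ_t(b))`, where the angle `h` is an integral over the flow
line of `b`. -/
lemma IsLift.hasLocalFlow [IsManifold 𝓘(ℝ, E) ∞ M] [IsManifold 𝓘(ℝ, F) ∞ B]
    (hπ : IsPrincipalCircleBundle (E := E) (F := F) π)
    (hα : IsConnectionForm α) (hY : IsLift π α H X Y) (hH : ContMDiff 𝓘(ℝ, F) 𝓘(ℝ, ℝ) ∞ H)
    {ρ : ℝ × B → B} (hρ : IsFlow ρ X) (b₀ : B) :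
    ∃ V : Set B, IsOpen V ∧ b₀ ∈ V ∧ ∃ ε > 0, ∀ x₀ ∈ π ⁻¹' V, HasLocalFlow Y ε x₀ := by
  have := hπ.smooth_action
  obtain ⟨U, σ, τ, hb₀, hs⟩ := hπ.exists_isLocalSection b₀
  set χ := extChartAt 𝓘(ℝ, F) b₀ with hχ
  have hχo : IsOpen χ.target := isOpen_extChartAt_target _
  -- the base flow in the chart `χ`
  let f : ℝ × F → B := fun p => ρ (p.1, χ.symm p.2)
  have hf : ContMDiffOn 𝓘(ℝ, ℝ × F) 𝓘(ℝ, F) ∞ f (univ ×ˢ χ.target) := by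
    refine hρ.smooth.comp_contMDiffOn ?_
    refine (contDiff_fst.contMDiff.contMDiffOn).prodMk ?_
    exact (contMDiffOn_extChartAt_symm b₀).comp contDiff_snd.contMDiff.contMDiffOn
      fun p hp => hp.2
  set W : Set (ℝ × F) := (univ ×ˢ χ.target) ∩ f ⁻¹' U with hW
  have hWo : IsOpen W :=
    hf.continuousOn.isOpen_inter_preimage (isOpen_univ.prod hχo) hs.isOpen
  let m : ℝ × F → M := fun p => σ (f p)
  have hm : ContMDiffOn 𝓘(ℝ, ℝ × F) 𝓘(ℝ, E) ∞ m W :=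
    hs.smooth_section.comp (hf.mono inter_subset_left) fun p hp => hp.2
  -- the angular velocity needed to correct the curves `t ↦ σ(ρ_t b)`
  let k : ℝ × F → ℝ := fun p =>
    H (f p) - α (m p) ![mfderiv 𝓘(ℝ, ℝ × F) 𝓘(ℝ, E) m p ((1 : ℝ), (0 : F))]
  have hk : ContDiffOn ℝ ∞ k W := by
    refine ContDiffOn.sub ?_ (hα.smooth.contDiffOn_apply_mfderiv hWo hm _)
    exact contMDiffOn_iff_contDiffOn.1
      (hH.comp_contMDiffOn (hf.mono (inter_subset_left : W ⊆ _)))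
  have hmem : ((0 : ℝ), χ b₀) ∈ W := by
    refine ⟨⟨mem_univ _, χ.map_source (mem_extChartAt_source _)⟩, ?_⟩
    simp only [mem_preimage, f, hρ.zero]
    rwa [χ.left_inv (mem_extChartAt_source _)]
  obtain ⟨S, hS, D, hD, hSD⟩ := mem_nhds_prod_iff.1 (hWo.mem_nhds hmem)
  obtain ⟨a, ha, haS⟩ := Metric.mem_nhds_iff.1 hS
  obtain ⟨D', hD'D, hD'o, hbD'⟩ := mem_nhds_iff.1 hD
  have hsub : Ioo (-a) a ×ˢ D' ⊆ W := by
    rintro ⟨t, y⟩ ⟨ht, hy⟩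
    refine hSD ⟨haS ?_, hD'D hy⟩
    rw [Metric.mem_ball, Real.dist_0_eq_abs]
    exact abs_lt.2 ht
  let h : ℝ × F → ℝ := fun p => ∫ s in (0 : ℝ)..p.1, k (s, p.2)
  have hh := contDiffOn_primitive hD'o (hk.mono hsub)
  set ε := a / 3 with hε
  have hεpos : 0 < ε := by positivity
  have hεa : Ioo (-ε) ε ⊆ Ioo (-a) a := Ioo_subset_Ioo (by linarith) (by linarith)
  set V : Set B := χ.source ∩ χ ⁻¹' D' with hV
  have hVo : IsOpen V :=
    (continuousOn_extChartAt b₀).isOpen_inter_preimage (isOpen_extChartAt_source _) hD'o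
  have hfV : ∀ b ∈ V, ∀ t, f (t, χ b) = ρ (t, b) := fun b hb t => by
    simp only [f, χ.left_inv hb.1]
  have hWV : ∀ b ∈ V, ∀ t ∈ Ioo (-ε) ε, (t, χ b) ∈ W := fun b hb t ht => hsub ⟨hεa ht, hb.2⟩
  have hρU : ∀ b ∈ V, ∀ t ∈ Ioo (-ε) ε, ρ (t, b) ∈ U := fun b hb t ht => by
    rw [← hfV b hb]; exact (hWV b hb t ht).2
  have h0 : (0 : ℝ) ∈ Ioo (-ε) ε := ⟨by linarith, hεpos⟩
  have hVU : V ⊆ U := fun b hb => by simpa [hρ.zero] using hρU b hb 0 h0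
  have hπV : IsOpen (π ⁻¹' V) := hVo.preimage hπ.smooth_proj.continuous
  let φ : ℝ × M → M := fun p =>
    Circle.exp (h (p.1, χ (π p.2))) • τ p.2 • σ (ρ (p.1, π p.2))
  have hπ2 : ContMDiffOn (𝓘(ℝ, ℝ).prod 𝓘(ℝ, E)) 𝓘(ℝ, F) ∞ (fun p : ℝ × M => π p.2)
      (Ioo (-ε) ε ×ˢ (π ⁻¹' V)) := (hπ.smooth_proj.comp contMDiff_snd).contMDiffOn
  have hφ : ContMDiffOn (𝓘(ℝ, ℝ).prod 𝓘(ℝ, E)) 𝓘(ℝ, E) ∞ φ (Ioo (-ε) ε ×ˢ (π ⁻¹' V)) := by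
    have e1 : ContMDiffOn (𝓘(ℝ, ℝ).prod 𝓘(ℝ, E)) 𝓘(ℝ, ℝ × F) ∞
        (fun p : ℝ × M => (p.1, χ (π p.2))) (Ioo (-ε) ε ×ˢ (π ⁻¹' V)) := by
      refine contMDiffOn_fst.prodMk_space ?_
      refine (contMDiffOn_extChartAt (I := 𝓘(ℝ, F)) (x := b₀)).comp hπ2 ?_
      intro p hp
      have := hp.2.1
      rwa [hχ, extChartAt_source] at this
    have e2 : ContMDiffOn (𝓘(ℝ, ℝ).prod 𝓘(ℝ, E)) (𝓡 1) ∞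
        (fun p : ℝ × M => Circle.exp (h (p.1, χ (π p.2)))) (Ioo (-ε) ε ×ˢ (π ⁻¹' V)) := by
      refine contMDiff_circleExp.comp_contMDiffOn ?_
      exact hh.contMDiffOn.comp e1 fun p hp => ⟨hp.1, hp.2.2⟩
    have e3 : ContMDiffOn (𝓘(ℝ, ℝ).prod 𝓘(ℝ, E)) (𝓡 1) ∞
        (fun p : ℝ × M => τ p.2) (Ioo (-ε) ε ×ˢ (π ⁻¹' V)) :=
      hs.smooth_angle.comp contMDiffOn_snd fun p hp => hVU hp.2
    have e4 : ContMDiffOn (𝓘(ℝ, ℝ).prod 𝓘(ℝ, E)) 𝓘(ℝ, E) ∞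
        (fun p : ℝ × M => σ (ρ (p.1, π p.2))) (Ioo (-ε) ε ×ˢ (π ⁻¹' V)) := by
      refine hs.smooth_section.comp (hρ.smooth.comp_contMDiffOn (contMDiffOn_fst.prodMk hπ2)) ?_
      exact fun p hp => hρU _ hp.2 _ hp.1
    exact e2.smul (e3.smul e4)
  refine ⟨V, hVo, ⟨mem_extChartAt_source _, hbD'⟩, ε, hεpos, fun x₀ hx₀ =>
    ⟨π ⁻¹' V, hπV, hx₀, φ, hφ, ?_, ?_⟩⟩
  · intro x hx
    simp only [φ, h, intervalIntegral.integral_same, Circle.exp_zero, one_smul, hρ.zero]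
    exact hs.angle_smul_section x (hVU hx)
  · intro x hx t ht
    have hb : π x ∈ V := hx
    set b := π x with hbx
    set y := χ b with hy
    refine HasMFDerivAt.hasMFDerivWithinAt ?_
    let c : ℝ → M := fun s => φ (s, x)
    have hc : MDifferentiableAt 𝓘(ℝ, ℝ) 𝓘(ℝ, E) c t := by
      have e1 : ContMDiffAt (𝓘(ℝ, ℝ).prod 𝓘(ℝ, E)) 𝓘(ℝ, E) ∞ φ (t, x) :=
        hφ.contMDiffAt ((isOpen_Ioo.prod hπV).mem_nhds ⟨ht, hx⟩)
      exact (e1.comp t (f := fun s : ℝ => (s, x))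
        (contMDiffAt_id.prodMk contMDiffAt_const)).mdifferentiableAt (by simp)
    have hπc : ∀ s ∈ Ioo (-ε) ε, π (c s) = ρ (s, b) := fun s hs' => by
      simp only [c, φ, hπ.proj_smul]
      exact hs.proj_section _ (hρU b hb s hs')
    have hπct : π (c t) = ρ (t, b) := hπc t ht
    refine hY.hasMFDerivAt hπ hα (c := c) hc ?_ ?_
    · have e1 : π ∘ c =ᶠ[𝓝 t] fun s => ρ (s, b) := by
        filter_upwards [isOpen_Ioo.mem_nhds ht] with s hs' using hπc s hs'
      have e2 := (hρ.integralCurve b t).congr_of_eventuallyEq e1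
      have e3 : ∀ b' : B, b' = ρ (t, b) → (X b' : F) = X (ρ (t, b)) := by
        rintro b' rfl; rfl
      refine e2.congr_mfderiv ?_
      ext
      exact congrArg (fun w : F => (1 : ℝ) • w) (e3 _ hπct).symm
    · have hWt : (t, y) ∈ W := hWV b hb t ht
      -- the curve before the angular correction
      let m₁ : ℝ → M := fun s => σ (ρ (s, b))
      have hm₁ : m₁ = m ∘ fun s : ℝ => (s, y) := by
        ext s; simp only [m₁, m, Function.comp, hy, hfV b hb]
      have hmd : MDifferentiableAt 𝓘(ℝ, ℝ × F) 𝓘(ℝ, E) m (t, y) :=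
        (hm.contMDiffAt (hWo.mem_nhds hWt)).mdifferentiableAt (by simp)
      have hι : HasMFDerivAt 𝓘(ℝ, ℝ) 𝓘(ℝ, ℝ × F) (fun s : ℝ => (s, y)) t
          (ContinuousLinearMap.inl ℝ ℝ F) := (hasFDerivAt_prodMk_left t y).hasMFDerivAt
      have hm₁d := HasMFDerivAt.comp (f := fun s : ℝ => (s, y)) t hmd.hasMFDerivAt hι
      rw [← hm₁] at hm₁d
      have hzm : MDifferentiableAt 𝓘(ℝ, ℝ) 𝓘(ℝ, E) (fun s => τ x • m₁ s) t :=
        ((contMDiff_circle_smul (τ x)).contMDiffAt.mdifferentiableAt (by simp)).comp t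
          hm₁d.mdifferentiableAt
      have hθ : HasMFDerivAt 𝓘(ℝ, ℝ) 𝓘(ℝ, ℝ) (fun s => h (s, y)) t
          ((1 : ℝ →L[ℝ] ℝ).smulRight (k (t, y))) :=
        (hasDerivAt_primitive (hk.mono hsub) (hεa ht) hb.2).hasFDerivAt.hasMFDerivAt
      have e1 := hα.apply_mfderiv_exp_smul hθ hzm (1 : ℝ)
      have e0 := hα.apply_mfderiv_smul (τ x) hm₁d.mdifferentiableAt (1 : ℝ)
      refine e1.trans ((congrArg (_ + ·) e0).trans ?_)
      rw [hπct, ← hfV b hb]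
      have e2 : α (m₁ t) ![mfderiv 𝓘(ℝ, ℝ) 𝓘(ℝ, E) m₁ t (1 : ℝ)] =
          α (m (t, y)) ![mfderiv 𝓘(ℝ, ℝ × F) 𝓘(ℝ, E) m (t, y) ((1 : ℝ), (0 : F))] := by
        rw [hm₁d.mfderiv]
        have e3 : ∀ z : M, z = m (t, y) → ∀ v : E, (α z : E [⋀^Fin 1]→L[ℝ] ℝ) (fun _ => v) =
            (α (m (t, y)) : E [⋀^Fin 1]→L[ℝ] ℝ) (fun _ => v) := by
          rintro z rfl v; rfl
        rw [← Form.toCLM_apply, ← Form.toCLM_apply]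
        exact e3 _ (congrFun hm₁ t) _
      rw [e2]
      change (1 : ℝ) • (H (f (t, y)) - _) + _ = _
      rw [one_smul, sub_add_cancel]

/-- The lift of a complete vector field on a compact base is complete. -/
theorem IsLift.exists_isFlow [IsManifold 𝓘(ℝ, E) ∞ M] [IsManifold 𝓘(ℝ, F) ∞ B]
    [CompactSpace B] [T2Space M]
    [CompleteSpace E] (hπ : IsPrincipalCircleBundle (E := E) (F := F) π)
    (hα : IsConnectionForm α) (hY : IsLift π α H X Y) (hH : ContMDiff 𝓘(ℝ, F) 𝓘(ℝ, ℝ) ∞ H)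
    {ρ : ℝ × B → B} (hρ : IsFlow ρ X) : ∃ Φ : ℝ × M → M, IsFlow Φ Y := by
  have key : ∃ ε > 0, ∀ x₀ ∈ π ⁻¹' (univ : Set B), HasLocalFlow Y ε x₀ := by
    refine isCompact_univ.induction_on (p := fun S => ∃ ε > 0, ∀ x₀ ∈ π ⁻¹' S,
      HasLocalFlow Y ε x₀) ⟨1, one_pos, fun x hx => hx.elim⟩ ?_ ?_ ?_
    · rintro S T hST ⟨ε, hε, h⟩
      exact ⟨ε, hε, fun x hx => h x (hST hx)⟩
    · rintro S T ⟨ε, hε, h⟩ ⟨δ, hδ, h'⟩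
      refine ⟨min ε δ, lt_min hε hδ, fun x hx => hx.elim (fun hx => ?_) fun hx => ?_⟩
      · exact (h x hx).mono (min_le_left _ _)
      · exact (h' x hx).mono (min_le_right _ _)
    · intro b _
      obtain ⟨V, hV, hbV, h⟩ := hY.hasLocalFlow hπ hα hH hρ b
      exact ⟨V, mem_nhdsWithin_of_mem_nhds (hV.mem_nhds hbV), h⟩
  obtain ⟨ε, hε, h⟩ := key
  exact exists_isFlow_of_localFlow hε fun x => h x (mem_univ _)

end LiftedFlow

/-! ### Invariance of the connection form and holonomy -/

section Invariance

variable {E : Type*} [NormedAddCommGroup E] [NormedSpace ℝ E]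
  {M : Type*} [TopologicalSpace M] [ChartedSpace E M]
  {F : Type*} [NormedAddCommGroup F] [NormedSpace ℝ F]
  {B : Type*} [TopologicalSpace B] [ChartedSpace F B]

lemma Form.apply_congr {k : ℕ} (α : Form E M k) {x y : M} (h : x = y) (v : Fin k → E) :
    (α x : E [⋀^Fin k]→L[ℝ] ℝ) v = (α y : E [⋀^Fin k]→L[ℝ] ℝ) v := by
  subst h; rfl

variable [MulAction Circle M]
  {π : M → B} {α : Form E M 1} {H : B → ℝ} {X : VectorField F B} {Y : VectorField E M}
  {Φ : ℝ × M → M} {ρ : ℝ × B → B}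

lemma IsLift.hasMFDerivAt_proj (hπ : IsPrincipalCircleBundle (E := E) (F := F) π)
    (hY : IsLift π α H X Y) (hΦ : IsFlow Φ Y) (t : ℝ) (x : M) :
    HasMFDerivAt 𝓘(ℝ, ℝ) 𝓘(ℝ, F) (fun s => π (Φ (s, x))) t
      ((1 : ℝ →L[ℝ] ℝ).smulRight (X (π (Φ (t, x))))) := by
  have hπd : MDifferentiableAt 𝓘(ℝ, E) 𝓘(ℝ, F) π (Φ (t, x)) :=
    hπ.smooth_proj.contMDiffAt.mdifferentiableAt (by simp)
  have h1 := HasMFDerivAt.comp (f := fun s => Φ (s, x)) t hπd.hasMFDerivAt (hΦ.integralCurve x t)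
  refine h1.congr_mfderiv ?_
  ext
  have h2 : mfderiv 𝓘(ℝ, E) 𝓘(ℝ, F) π (Φ (t, x)) ((1 : ℝ) • Y (Φ (t, x))) =
      (1 : ℝ) • X (π (Φ (t, x))) := by
    rw [one_smul, one_smul, hY.proj]
  exact h2

/-- The flow of a lift covers the flow on the base. -/
lemma IsLift.proj_flow [IsManifold 𝓘(ℝ, F) ∞ B] [T2Space B] [CompleteSpace F]
    (hπ : IsPrincipalCircleBundle (E := E) (F := F) π) (hY : IsLift π α H X Y)
    (hΦ : IsFlow Φ Y) (hρ : IsFlow ρ X) (t : ℝ) (x : M) : π (Φ (t, x)) = ρ (t, π x) := by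
  have := hρ.eq_of_isMIntegralCurve (c := fun s => π (Φ (s, x)))
    (fun s => hY.hasMFDerivAt_proj hπ hΦ s x) t
  simpa only [hΦ.zero] using this

/-- The flow of a lift commutes with the circle action. -/
lemma IsLift.flow_smul [IsManifold 𝓘(ℝ, E) ∞ M] [T2Space M] [CompleteSpace E]
    (hπ : IsPrincipalCircleBundle (E := E) (F := F) π) (hα : IsConnectionForm α)
    (hY : IsLift π α H X Y) (hΦ : IsFlow Φ Y) (t : ℝ) (z : Circle) (x : M) :
    Φ (t, z • x) = z • Φ (t, x) := by
  have := hπ.smooth_action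
  have hint : IsMIntegralCurve (I := 𝓘(ℝ, E)) (fun s => z • Φ (s, x)) Y := by
    intro s
    have hΦd : MDifferentiableAt 𝓘(ℝ, ℝ) 𝓘(ℝ, E) (fun s => Φ (s, x)) s :=
      (hΦ.integralCurve x s).mdifferentiableAt
    refine hY.hasMFDerivAt hπ hα (c := fun s => z • Φ (s, x)) ?_ ?_ ?_
    · exact ((contMDiff_circle_smul z).contMDiffAt.mdifferentiableAt (by simp)).comp s hΦd
    · have e : π ∘ (fun s => z • Φ (s, x)) = fun s => π (Φ (s, x)) := by
        ext s; exact hπ.proj_smul z _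
      rw [e, hπ.proj_smul]
      exact hY.hasMFDerivAt_proj hπ hΦ s x
    · refine (hα.apply_mfderiv_smul z hΦd (1 : ℝ)).trans ?_
      rw [(hΦ.integralCurve x s).mfderiv, hπ.proj_smul, ← hY.vertical]
      change α _ ![(1 : ℝ) • Y _] = _
      rw [one_smul]
  have h1 := hΦ.eq_of_isMIntegralCurve hint t
  simpa only [hΦ.zero] using h1.symm

/-- The flow of the lift of the Hamiltonian vector field of `H` with vertical part `H` preserves the
connection form. For a vector `v` at `x`, the map `c(t, y) = Φ_t(y)` satisfies
`d/dt (α(∂_v c)) = ∂_v (α(∂_t c)) + dα(∂_t c, ∂_v c) = dH(Tπ ∂_v c) + Ω(X, Tπ ∂_v c) = 0`. -/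
lemma IsLift.pullback_flow [IsManifold 𝓘(ℝ, E) ∞ M]
    (hπ : IsPrincipalCircleBundle (E := E) (F := F) π) (hα : IsConnectionForm α)
    {Ω : Form F B 2} (hcurv : ∀ x, α.d x = Ω.pullback π x)
    (hH : ContMDiff 𝓘(ℝ, F) 𝓘(ℝ, ℝ) ∞ H) (hX : IsHamiltonianVectorField Ω H X)
    (hY : IsLift π α H X Y) (hΦ : IsFlow Φ Y) (t : ℝ) (x : M) :
    α.pullback (fun y => Φ (t, y)) x = α x := by
  set ψ := extChartAt 𝓘(ℝ, E) x with hψ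
  have hψo : IsOpen ψ.target := isOpen_extChartAt_target _
  have hyx : ψ x ∈ ψ.target := ψ.map_source (mem_extChartAt_source _)
  let c : ℝ × E → M := fun p => Φ (p.1, ψ.symm p.2)
  set W : Set (ℝ × E) := univ ×ˢ ψ.target with hW
  have hWo : IsOpen W := isOpen_univ.prod hψo
  have hc : ContMDiffOn 𝓘(ℝ, ℝ × E) 𝓘(ℝ, E) ∞ c W := by
    refine hΦ.smooth.comp_contMDiffOn ?_
    refine (contDiff_fst.contMDiff.contMDiffOn).prodMk ?_
    exact (contMDiffOn_extChartAt_symm x).comp contDiff_snd.contMDiff.contMDiffOn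
      fun p hp => hp.2
  have hcd : ∀ p ∈ W, MDifferentiableAt 𝓘(ℝ, ℝ × E) 𝓘(ℝ, E) c p := fun p hp =>
    (hc.contMDiffAt (hWo.mem_nhds hp)).mdifferentiableAt (by simp)
  have hπd : ∀ z, MDifferentiableAt 𝓘(ℝ, E) 𝓘(ℝ, F) π z := fun z =>
    hπ.smooth_proj.contMDiffAt.mdifferentiableAt (by simp)
  -- the time derivative of `c` is `Y`
  have hct : ∀ p ∈ W, mfderiv 𝓘(ℝ, ℝ × E) 𝓘(ℝ, E) c p ((1 : ℝ), (0 : E)) = Y (c p) := by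
    rintro ⟨s, y⟩ hp
    have hι : HasMFDerivAt 𝓘(ℝ, ℝ) 𝓘(ℝ, ℝ × E) (fun s : ℝ => (s, y)) s
        (ContinuousLinearMap.inl ℝ ℝ E) := (hasFDerivAt_prodMk_left s y).hasMFDerivAt
    have h1 := HasMFDerivAt.comp (f := fun s : ℝ => (s, y)) s (hcd _ hp).hasMFDerivAt hι
    have h2 := hasMFDerivAt_unique h1 (hΦ.integralCurve (ψ.symm y) s)
    have h3 := congrArg (fun L : ℝ →L[ℝ] E => L 1) h2
    exact h3.trans (one_smul ℝ _)
  have hHc : ∀ p ∈ W, α (c p) ![mfderiv 𝓘(ℝ, ℝ × E) 𝓘(ℝ, E) c p ((1 : ℝ), (0 : E))] =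
      H (π (c p)) := fun p hp => by rw [hct p hp, hY.vertical]
  -- the conservation law
  have hcons : ∀ p ∈ W, ∀ e : E, fderiv ℝ (fun q => α (c q)
      ![mfderiv 𝓘(ℝ, ℝ × E) 𝓘(ℝ, E) c q ((0 : ℝ), e)]) p ((1 : ℝ), (0 : E)) = 0 := by
    intro p hp e
    have h1 := hα.smooth.d_apply_mfderiv hWo hc hp ((1 : ℝ), (0 : E)) ((0 : ℝ), e)
    have h2 : (fun q => α (c q) ![mfderiv 𝓘(ℝ, ℝ × E) 𝓘(ℝ, E) c q ((1 : ℝ), (0 : E))]) =ᶠ[𝓝 p]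
        fun q => H (π (c q)) := by
      filter_upwards [hWo.mem_nhds hp] with q hq using hHc q hq
    have hHd : MDifferentiableAt 𝓘(ℝ, F) 𝓘(ℝ, ℝ) H (π (c p)) :=
      hH.contMDiffAt.mdifferentiableAt (by simp)
    have h3 : fderiv ℝ (fun q => H (π (c q))) p ((0 : ℝ), e) =
        mfderiv 𝓘(ℝ, F) 𝓘(ℝ, ℝ) H (π (c p)) (mfderiv 𝓘(ℝ, E) 𝓘(ℝ, F) π (c p)
          (mfderiv 𝓘(ℝ, ℝ × E) 𝓘(ℝ, E) c p ((0 : ℝ), e))) := by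
      have e1 := (hHd.hasMFDerivAt.comp p (f := fun q => π (c q))
        ((hπd (c p)).hasMFDerivAt.comp p (f := c) (hcd p hp).hasMFDerivAt)).mfderiv
      rw [← mfderiv_eq_fderiv]
      exact congrArg (fun L : ℝ × E →L[ℝ] ℝ => L ((0 : ℝ), e)) e1
    have h4 := hX (π (c p)) (mfderiv 𝓘(ℝ, E) 𝓘(ℝ, F) π (c p)
          (mfderiv 𝓘(ℝ, ℝ × E) 𝓘(ℝ, E) c p ((0 : ℝ), e)))
    have h5 : α.d (c p) ![mfderiv 𝓘(ℝ, ℝ × E) 𝓘(ℝ, E) c p ((1 : ℝ), (0 : E)),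
        mfderiv 𝓘(ℝ, ℝ × E) 𝓘(ℝ, E) c p ((0 : ℝ), e)] =
        Ω (π (c p)) ![X (π (c p)), mfderiv 𝓘(ℝ, E) 𝓘(ℝ, F) π (c p)
          (mfderiv 𝓘(ℝ, ℝ × E) 𝓘(ℝ, E) c p ((0 : ℝ), e))] := by
      rw [hct p hp, hcurv, ← hY.proj]
      change Ω (π (c p)) _ = _
      congr 1
      ext i; fin_cases i <;> rfl
    rw [h2.fderiv_eq, h3, h5, h4] at h1
    exact (sub_eq_neg_self.1 h1.symm)
  ext w
  set v : E := w 0 with hv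
  have hw : w = ![v] := by ext i; fin_cases i; rfl
  set e : E := mfderiv 𝓘(ℝ, E) 𝓘(ℝ, E) ψ x v with he
  let g : ℝ → ℝ := fun s => α (c (s, ψ x))
    ![mfderiv 𝓘(ℝ, ℝ × E) 𝓘(ℝ, E) c (s, ψ x) ((0 : ℝ), e)]
  have hgd : ∀ s, HasDerivAt g 0 s := by
    intro s
    have h1 := (((hα.smooth.contDiffOn_apply_mfderiv hWo hc ((0 : ℝ), e)).contDiffAt
      (hWo.mem_nhds (⟨mem_univ s, hyx⟩ : (s, ψ x) ∈ W))).differentiableAt (by simp)).hasFDerivAt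
    have h2 := (h1.comp s (hasFDerivAt_prodMk_left s (ψ x))).hasDerivAt
    convert! h2 using 1
    exact (hcons (s, ψ x) ⟨mem_univ _, hyx⟩ e).symm
  have hgconst : g t = g 0 :=
    is_const_of_deriv_eq_zero (fun s => (hgd s).differentiableAt) (fun s => (hgd s).deriv) t 0
  have hg : ∀ s, g s = α (Φ (s, x)) ![mfderiv 𝓘(ℝ, E) 𝓘(ℝ, E) (fun y => Φ (s, y)) x v] := by
    intro s
    have hψd : MDifferentiableAt 𝓘(ℝ, E) 𝓘(ℝ, E) ψ x :=
      mdifferentiableAt_extChartAt (mem_chart_source _ _)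
    have hι : HasMFDerivAt 𝓘(ℝ, E) 𝓘(ℝ, ℝ × E) (fun y : E => (s, y)) (ψ x)
        (ContinuousLinearMap.inr ℝ ℝ E) := (hasFDerivAt_prodMk_right s (ψ x)).hasMFDerivAt
    have h1 := HasMFDerivAt.comp (f := fun y : M => (s, ψ y)) x
      (hcd (s, ψ x) ⟨mem_univ _, hyx⟩).hasMFDerivAt
      (HasMFDerivAt.comp (f := ψ) x hι hψd.hasMFDerivAt)
    have h2 : (fun y => Φ (s, y)) =ᶠ[𝓝 x] c ∘ fun y : M => (s, ψ y) := by
      filter_upwards [(isOpen_extChartAt_source (I := 𝓘(ℝ, E)) x).mem_nhds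
        (mem_extChartAt_source _)] with y hy
      simp only [c, Function.comp]
      rw [ψ.left_inv hy]
    have h3 := (h1.congr_of_eventuallyEq h2).mfderiv
    have h4 := congrArg (fun L : E →L[ℝ] E => L v) h3
    have h5 : c (s, ψ x) = Φ (s, x) := h2.eq_of_nhds.symm
    have h6 := α.apply_congr h5 (fun _ => mfderiv 𝓘(ℝ, ℝ × E) 𝓘(ℝ, E) c (s, ψ x) ((0 : ℝ), e))
    simp only [g]
    rw [← Form.toCLM_apply, ← Form.toCLM_apply]
    refine Eq.trans h6 ?_
    exact congrArg (fun u : E => (α (Φ (s, x)) : E [⋀^Fin 1]→L[ℝ] ℝ) (fun _ => u)) h4.symm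
  have h0 : g 0 = α x ![v] := by
    rw [hg]
    have e1 : (fun y => Φ (0, y)) = id := funext hΦ.zero
    rw [e1, mfderiv_id, ← Form.toCLM_apply, ← Form.toCLM_apply]
    exact α.apply_congr (hΦ.zero x) _
  have h1 : α (Φ (t, x)) ![mfderiv 𝓘(ℝ, E) 𝓘(ℝ, E) (fun y => Φ (t, y)) x v] = α x ![v] := by
    rw [← hg, hgconst, h0]
  rw [← Form.toCLM_apply, ← Form.toCLM_apply] at h1
  rw [hw]
  refine Eq.trans ?_ (h1.trans (α.toCLM_apply x v))
  change α (Φ (t, x)) _ = α (Φ (t, x)) _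
  congr 1
  ext i; fin_cases i; rfl

end Invariance

section Holonomy

variable {E : Type*} [NormedAddCommGroup E] [NormedSpace ℝ E]
  {M : Type*} [TopologicalSpace M] [ChartedSpace E M]
  {F : Type*} [NormedAddCommGroup F] [NormedSpace ℝ F]
  {B : Type*} [TopologicalSpace B] [ChartedSpace F B]
  [MulAction Circle M] {π : M → B} {α : Form E M 1}

lemma IsPrincipalCircleBundle.exists_proj_eq
    (hπ : IsPrincipalCircleBundle (E := E) (F := F) π) (b : B) : ∃ x, π x = b := by
  obtain ⟨U, σ, τ, hb, hs⟩ := hπ.exists_isLocalSection b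
  exact ⟨σ b, hs.proj_section b hb⟩

variable [IsManifold 𝓘(ℝ, F) ∞ B]

/-- A gauge transformation preserving a connection form is locally a constant rotation: if it is
`x ↦ exp(iθ(π(x))) • z₀ • x`, then it changes the form by `dθ`. -/
lemma IsConnectionForm.exists_eq_smul_of_pullback_eq
    (hπ : IsPrincipalCircleBundle (E := E) (F := F) π) (hα : IsConnectionForm α) {ψ : M → M}
    (hψ : ContMDiff 𝓘(ℝ, E) 𝓘(ℝ, E) ∞ ψ) (hψπ : ∀ x, π (ψ x) = π x)
    (hψs : ∀ (z : Circle) (x : M), ψ (z • x) = z • ψ x) (hψα : ∀ x, α.pullback ψ x = α x) (b₀ : B) :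
    ∃ V : Set B, IsOpen V ∧ b₀ ∈ V ∧ ∃ z₀ : Circle, ∀ x ∈ π ⁻¹' V, ψ x = z₀ • x := by
  have := hπ.smooth_action
  obtain ⟨U, σ, τ, hb₀, hs⟩ := hπ.exists_isLocalSection b₀
  let ζ : B → Circle := fun b => τ (ψ (σ b))
  have hψσ : ∀ b ∈ U, ψ (σ b) = ζ b • σ b := by
    intro b hb
    have h1 : π (ψ (σ b)) = b := by rw [hψπ, hs.proj_section b hb]
    have h2 := hs.angle_smul_section (ψ (σ b)) (by rw [mem_preimage, h1]; exact hb)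
    rw [h1] at h2
    exact h2.symm
  have hψζ : ∀ x ∈ π ⁻¹' U, ψ x = ζ (π x) • x := by
    intro x hx
    have h1 := hs.angle_smul_section x hx
    rw [← h1, hπ.proj_smul, hs.proj_section _ hx, hψs, hψσ _ hx, smul_smul, smul_smul, mul_comm]
  have hψσs : ContMDiffOn 𝓘(ℝ, F) 𝓘(ℝ, E) ∞ (fun b => ψ (σ b)) U :=
    hψ.comp_contMDiffOn hs.smooth_section
  have hζ : ContMDiffOn 𝓘(ℝ, F) (𝓡 1) ∞ ζ U := by
    refine hs.smooth_angle.comp hψσs fun b hb => ?_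
    rw [mem_preimage, mem_preimage, hψπ, hs.proj_section b hb]
    exact hb
  set z₀ := ζ b₀ with hz₀
  have hζ' : ContMDiffOn 𝓘(ℝ, F) (𝓡 1) ∞ (fun b => ζ b * z₀⁻¹) U := hζ.mul contMDiffOn_const
  set V₁ : Set B := U ∩ (fun b => ζ b * z₀⁻¹) ⁻¹' {z : Circle | (z : ℂ) ∈ Complex.slitPlane}
    with hV₁
  have hV₁o : IsOpen V₁ :=
    hζ'.continuousOn.isOpen_inter_preimage hs.isOpen isOpen_circle_slitPlane
  let θ : B → ℝ := fun b => Complex.arg ((ζ b * z₀⁻¹ : Circle) : ℂ)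
  have hθ : ContMDiffOn 𝓘(ℝ, F) 𝓘(ℝ, ℝ) ∞ θ V₁ :=
    contMDiffOn_circle_arg.comp (hζ'.mono inter_subset_left) fun b hb => hb.2
  have hexp : ∀ b, Circle.exp (θ b) * z₀ = ζ b := fun b => by
    simp only [θ, Circle.exp_arg, inv_mul_cancel_right]
  have hθ0 : θ b₀ = 0 := by simp [θ, ← hz₀]
  set χ := extChartAt 𝓘(ℝ, F) b₀ with hχ
  have hχo : IsOpen χ.target := isOpen_extChartAt_target _
  have hχs := contMDiffOn_extChartAt_symm (I := 𝓘(ℝ, F)) (n := ∞) b₀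
  set D : Set F := χ.target ∩ χ.symm ⁻¹' V₁ with hD
  have hDo : IsOpen D := hχs.continuousOn.isOpen_inter_preimage hχo hV₁o
  have hbD : χ b₀ ∈ D := by
    refine ⟨χ.map_source (mem_extChartAt_source _), ?_⟩
    rw [mem_preimage, χ.left_inv (mem_extChartAt_source _)]
    exact ⟨hb₀, by simp [← hz₀]⟩
  let θ' : F → ℝ := fun y => θ (χ.symm y)
  have hθ' : ContDiffOn ℝ ∞ θ' D := contMDiffOn_iff_contDiffOn.1
    (hθ.comp (hχs.mono inter_subset_left) fun y hy => hy.2)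
  let m : F → M := fun y => σ (χ.symm y)
  have hm : ContMDiffOn 𝓘(ℝ, F) 𝓘(ℝ, E) ∞ m D :=
    hs.smooth_section.comp (hχs.mono inter_subset_left) fun y hy => hy.2.1
  have hψm : ∀ y ∈ D, ψ (m y) = Circle.exp (θ' y) • z₀ • m y := by
    intro y hy
    rw [smul_smul, hexp]
    exact hψσ _ hy.2.1
  have hfd : ∀ y ∈ D, fderiv ℝ θ' y = 0 := by
    intro y hy
    have hyn := hDo.mem_nhds hy
    have hmd : MDifferentiableAt 𝓘(ℝ, F) 𝓘(ℝ, E) m y :=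
      (hm.contMDiffAt hyn).mdifferentiableAt (by simp)
    have hψd : MDifferentiableAt 𝓘(ℝ, E) 𝓘(ℝ, E) ψ (m y) :=
      hψ.contMDiffAt.mdifferentiableAt (by simp)
    have hzm : MDifferentiableAt 𝓘(ℝ, F) 𝓘(ℝ, E) (fun y => z₀ • m y) y :=
      ((contMDiff_circle_smul z₀).contMDiffAt.mdifferentiableAt (by simp)).comp y hmd
    have hθd : HasMFDerivAt 𝓘(ℝ, F) 𝓘(ℝ, ℝ) θ' y (fderiv ℝ θ' y) :=
      ((hθ'.contDiffAt hyn).differentiableAt (by simp)).hasFDerivAt.hasMFDerivAt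
    ext v
    have h1 := hα.apply_mfderiv_exp_smul hθd hzm v
    have h2 := hα.apply_mfderiv_smul z₀ hmd v
    have h3 : (fun y => Circle.exp (θ' y) • z₀ • m y) =ᶠ[𝓝 y] ψ ∘ m := by
      filter_upwards [hyn] with q hq using (hψm q hq).symm
    rw [h3.mfderiv_eq, mfderiv_comp y hψd hmd] at h1
    have h4 := α.apply_congr (hψm y hy)
      (fun _ => mfderiv 𝓘(ℝ, E) 𝓘(ℝ, E) ψ (m y) (mfderiv 𝓘(ℝ, F) 𝓘(ℝ, E) m y v))
    have h5 := congrArg (fun β : E [⋀^Fin 1]→L[ℝ] ℝ =>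
      β (fun _ => mfderiv 𝓘(ℝ, F) 𝓘(ℝ, E) m y v)) (hψα (m y))
    rw [h2, ← Form.toCLM_apply, ← Form.toCLM_apply] at h1
    have h6 := (h1.symm.trans h4.symm).trans h5
    exact add_eq_right.1 h6
  obtain ⟨r, hr, hrD⟩ := Metric.isOpen_iff.1 hDo _ hbD
  have hconst : ∀ y ∈ Metric.ball (χ b₀) r, θ' y = 0 := by
    intro y hy
    have h1 := Metric.isOpen_ball.is_const_of_fderiv_eq_zero
      (convex_ball (χ b₀) r).isPreconnected
      ((hθ'.differentiableOn (by simp)).mono hrD) (fun q hq => hfd q (hrD hq)) hy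
      (Metric.mem_ball_self hr)
    rw [h1]
    simp only [θ']
    rw [χ.left_inv (mem_extChartAt_source _), hθ0]
  refine ⟨χ.source ∩ χ ⁻¹' Metric.ball (χ b₀) r,
    (continuousOn_extChartAt b₀).isOpen_inter_preimage (isOpen_extChartAt_source _)
      Metric.isOpen_ball, ⟨mem_extChartAt_source _, Metric.mem_ball_self hr⟩, z₀, ?_⟩
  intro x hx
  have h1 := hrD hx.2
  have h2 := hconst _ hx.2
  simp only [θ', χ.left_inv hx.1] at h2
  have h3 : π x ∈ U := by
    have := h1.2.1
    rwa [χ.left_inv hx.1] at this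
  rw [hψζ x h3, ← hexp, h2, Circle.exp_zero, one_mul]

/-- Over a connected base, a gauge transformation which preserves a connection form and has a fixed
point is the identity. -/
theorem IsConnectionForm.eq_self_of_pullback_eq [PreconnectedSpace B]
    (hπ : IsPrincipalCircleBundle (E := E) (F := F) π) (hα : IsConnectionForm α) {ψ : M → M}
    (hψ : ContMDiff 𝓘(ℝ, E) 𝓘(ℝ, E) ∞ ψ) (hψπ : ∀ x, π (ψ x) = π x)
    (hψs : ∀ (z : Circle) (x : M), ψ (z • x) = z • ψ x) (hψα : ∀ x, α.pullback ψ x = α x)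
    {x₀ : M} (hx₀ : ψ x₀ = x₀) (x : M) : ψ x = x := by
  have hloc := hα.exists_eq_smul_of_pullback_eq hπ hψ hψπ hψs hψα
  -- a point of the base is good if `ψ` fixes a point, hence all points, of the fibre over it
  set S : Set B := {b | ∃ x, π x = b ∧ ψ x = x} with hS
  have hdich : ∀ b₀ : B, ∃ V : Set B, IsOpen V ∧ b₀ ∈ V ∧
      (V ⊆ S ∨ ∀ b ∈ V, b ∉ S) := by
    intro b₀
    obtain ⟨V, hV, hb₀, z₀, hz₀⟩ := hloc b₀
    refine ⟨V, hV, hb₀, ?_⟩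
    by_cases h1 : z₀ = 1
    · left
      intro b hb
      obtain ⟨y, rfl⟩ := hπ.exists_proj_eq b
      exact ⟨y, rfl, by rw [hz₀ y hb, h1, one_smul]⟩
    · right
      rintro b hb ⟨y, rfl, hy⟩
      rw [hz₀ y hb] at hy
      exact h1 (hπ.eq_one_of_smul_eq hy)
  have hclopen : IsClopen S := by
    constructor
    · rw [← isOpen_compl_iff, isOpen_iff_mem_nhds]
      intro b hb
      obtain ⟨V, hV, hbV, h | h⟩ := hdich b
      · exact (hb (h hbV)).elim
      · exact mem_of_superset (hV.mem_nhds hbV) h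
    · rw [isOpen_iff_mem_nhds]
      intro b hb
      obtain ⟨V, hV, hbV, h | h⟩ := hdich b
      · exact mem_of_superset (hV.mem_nhds hbV) h
      · exact (h b hbV hb).elim
  have huniv : S = univ := hclopen.eq_univ ⟨π x₀, x₀, rfl, hx₀⟩
  obtain ⟨V, hV, hxV, z₀, hz₀⟩ := hloc (π x)
  obtain ⟨y, hyx, hy⟩ : π x ∈ S := huniv ▸ mem_univ _
  have hyV : y ∈ π ⁻¹' V := by rw [mem_preimage, hyx]; exact hxV
  rw [hz₀ y hyV] at hy
  rw [hz₀ x hxV, hπ.eq_one_of_smul_eq hy, one_smul]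

end Holonomy

/-! ### Boothby–Wang bundles and torus actions -/

section Reeb

variable {E : Type*} [NormedAddCommGroup E] [NormedSpace ℝ E]
  {M : Type*} [TopologicalSpace M] [ChartedSpace E M]
  {F : Type*} [NormedAddCommGroup F] [NormedSpace ℝ F]
  {B : Type*} [TopologicalSpace B] [ChartedSpace F B]
  [MulAction Circle M] {π : M → B} {α : Form E M 1} {Ω : Form F B 2}

lemma IsBoothbyWangBundle.d_apply (h : IsBoothbyWangBundle π α Ω) (x : M)
    (v w : TangentSpace 𝓘(ℝ, E) x) :
    α.d x ![v, w] = Ω (π x) ![mfderiv 𝓘(ℝ, E) 𝓘(ℝ, F) π x v, mfderiv 𝓘(ℝ, E) 𝓘(ℝ, F) π x w] := by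
  rw [h.curvature]
  change Ω (π x) _ = Ω (π x) _
  congr 1
  ext i; fin_cases i <;> rfl

lemma IsBoothbyWangBundle.mfderiv_reeb_eq_zero (h : IsBoothbyWangBundle π α Ω)
    {R : VectorField E M} (hR : IsReebVectorField α R) (x : M) :
    mfderiv 𝓘(ℝ, E) 𝓘(ℝ, F) π x (R x) = 0 := by
  refine h.symplectic.nondegenerate _ _ fun u => ?_
  obtain ⟨w, rfl⟩ := h.bundle.mfderiv_surjective x u
  rw [← h.d_apply]
  exact (hR x).2 w

/-- The Reeb vector field of a Boothby–Wang bundle generates the principal circle action. -/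
lemma IsBoothbyWangBundle.reeb_eq (h : IsBoothbyWangBundle π α Ω)
    {R : VectorField E M} (hR : IsReebVectorField α R) (x : M) :
    R x = fundamentalVectorField x := by
  have h1 := eq_smul_fundamentalVectorField h.bundle h.connection (h.mfderiv_reeb_eq_zero hR x)
  rwa [(hR x).1, one_smul] at h1

/-- A connection form with symplectic curvature is a contact form. -/
lemma IsBoothbyWangBundle.isContactForm (h : IsBoothbyWangBundle π α Ω)
    {R : VectorField E M} (hR : IsReebVectorField α R) : IsContactForm α where
  smooth := h.connection.smooth
  ne_zero x hx := by
    have h1 := (hR x).1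
    rw [hx] at h1
    exact zero_ne_one h1
  nondegenerate x v hv hdv := by
    have h1 : mfderiv 𝓘(ℝ, E) 𝓘(ℝ, F) π x v = 0 := by
      refine h.symplectic.nondegenerate _ _ fun u => ?_
      obtain ⟨w, rfl⟩ := h.bundle.mfderiv_surjective x u
      -- replace `w` by its horizontal part
      have h2 := hdv (w - α x ![w] • R x) (by
        rw [← Form.toCLM_apply, map_sub, map_smul, Form.toCLM_apply, Form.toCLM_apply, (hR x).1,
          smul_eq_mul, mul_one, sub_self])
      rw [h.d_apply, map_sub, map_smul, h.mfderiv_reeb_eq_zero hR, smul_zero, sub_zero] at h2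
      exact h2
    have h3 := eq_smul_fundamentalVectorField h.bundle h.connection h1
    rwa [hv, zero_smul] at h3

lemma IsBoothbyWangBundle.isLift_liftedVectorField (h : IsBoothbyWangBundle π α Ω) {H : B → ℝ}
    {X : VectorField F B} {R Xh : VectorField E M} (hR : IsReebVectorField α R)
    (hXh : IsHorizontalLift π α X Xh) : IsLift π α H X (liftedVectorField π H R Xh) where
  proj x := by
    rw [liftedVectorField, map_add, map_smul, h.mfderiv_reeb_eq_zero hR, smul_zero, zero_add]
    exact (hXh x).2
  vertical x := by
    rw [liftedVectorField, ← Form.toCLM_apply, map_add, map_smul, Form.toCLM_apply,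
      Form.toCLM_apply, (hR x).1, (hXh x).1, smul_eq_mul, mul_one, add_zero]

end Reeb

section Actions

variable {E : Type*} [NormedAddCommGroup E] [NormedSpace ℝ E]
  {M : Type*} [TopologicalSpace M] [ChartedSpace E M]
  {F : Type*} [NormedAddCommGroup F] [NormedSpace ℝ F]
  {B : Type*} [TopologicalSpace B] [ChartedSpace F B]

/-- A vector field generating a circle action has a smooth flow of period `2π`. -/
lemma GeneratesCircleAction.exists_isFlow {X : VectorField F B} (hX : GeneratesCircleAction X) :
    ∃ ρ : ℝ × B → B, IsFlow ρ X ∧ ∀ b, ρ (2 * Real.pi, b) = b := by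
  obtain ⟨act, hsm, hint⟩ := hX
  refine ⟨fun p => Circle.exp p.1 • p.2, ⟨contMDiff_exp_smul, ?_, ?_, hint⟩, ?_⟩
  · intro b; simp
  · intro s t b; simp [smul_smul, Circle.exp_add]
  · intro b; simp

lemma generatesCircleAction_of_contMDiff {Y : VectorField E M} {a : Circle → M → M}
    (h1 : ∀ x, a 1 x = x) (hmul : ∀ z w x, a (z * w) x = a z (a w x))
    (ha : ContMDiff ((𝓡 1).prod 𝓘(ℝ, E)) 𝓘(ℝ, E) ∞ (fun p : Circle × M => a p.1 p.2))
    (hY : ∀ x, IsMIntegralCurve (I := 𝓘(ℝ, E)) (fun t : ℝ => a (Circle.exp t) x) Y) :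
    GeneratesCircleAction Y :=
  letI act : MulAction Circle M := { smul := a, one_smul := h1, mul_smul := hmul }
  ⟨act, ⟨ha⟩, hY⟩

lemma Form.pullback_comp_eq {α : Form E M 1} {f g : M → M} {x : M}
    (hf : MDifferentiableAt 𝓘(ℝ, E) 𝓘(ℝ, E) f (g x))
    (hg : MDifferentiableAt 𝓘(ℝ, E) 𝓘(ℝ, E) g x) (hfα : α.pullback f (g x) = α (g x))
    (hgα : α.pullback g x = α x) : α.pullback (fun y => f (g y)) x = α x := by
  rw [← hgα]
  have h1 : mfderiv 𝓘(ℝ, E) 𝓘(ℝ, E) (fun y => f (g y)) x = _ := mfderiv_comp x hf hg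
  simp only [Form.pullback] at hfα ⊢
  rw [h1, ← hfα]
  rfl

variable [MulAction Circle M] {π : M → B} {α : Form E M 1} {H : B → ℝ} {X : VectorField F B}
  {Y : VectorField E M}

/-- Over a zero `p₀` of `X` the flow of the lift is the rotation of the fibre with speed
`H(p₀)`. -/
lemma IsLift.flow_eq_of_eq_zero [IsManifold 𝓘(ℝ, E) ∞ M] [T2Space M] [CompleteSpace E]
    (hπ : IsPrincipalCircleBundle (E := E) (F := F) π) (hα : IsConnectionForm α)
    (hY : IsLift π α H X Y) {Φ : ℝ × M → M} (hΦ : IsFlow Φ Y) {x : M} (hx : X (π x) = 0) (t : ℝ) :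
    Φ (t, x) = Circle.exp (t * H (π x)) • x := by
  have := hπ.smooth_action
  have hint : IsMIntegralCurve (I := 𝓘(ℝ, E)) (fun s => Circle.exp (s * H (π x)) • x) Y := by
    intro s
    have hθ : HasMFDerivAt 𝓘(ℝ, ℝ) 𝓘(ℝ, ℝ) (fun s : ℝ => s * H (π x)) s
        ((1 : ℝ →L[ℝ] ℝ).smulRight (H (π x))) := by
      have := ((hasDerivAt_id s).mul_const (H (π x))).hasFDerivAt.hasMFDerivAt
      rw [one_mul] at this
      exact this
    have hc : MDifferentiableAt 𝓘(ℝ, ℝ) 𝓘(ℝ, E) (fun _ : ℝ => x) s := mdifferentiableAt_const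
    have hd : MDifferentiableAt 𝓘(ℝ, ℝ) 𝓘(ℝ, E)
        (fun s : ℝ => Circle.exp (s * H (π x)) • x) s :=
      ((hasMFDerivAt_exp_smul (E := E) _ x).comp (f := fun s : ℝ => s * H (π x)) s
        hθ).mdifferentiableAt
    refine hY.hasMFDerivAt hπ hα hd ?_ ?_
    · have e : π ∘ (fun s : ℝ => Circle.exp (s * H (π x)) • x) = fun _ => π x := by
        ext s; exact hπ.proj_smul _ x
      rw [e, hπ.proj_smul, hx]
      refine (hasMFDerivAt_const (π x) s).congr_mfderiv ?_
      ext
      exact (smul_zero (1 : ℝ)).symm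
    · refine (hα.apply_mfderiv_exp_smul hθ hc (1 : ℝ)).trans ?_
      rw [hπ.proj_smul, mfderiv_const, ← Form.toCLM_apply]
      change (1 : ℝ) • H (π x) + α.toCLM x 0 = _
      rw [map_zero, add_zero, one_smul]
  have h1 := hΦ.eq_of_isMIntegralCurve hint t
  simpa using h1.symm

/-- If the flow of the lift of a Hamiltonian circle action is `2π`-periodic, then it defines, together
with the principal circle action, a strict contact torus action. -/
theorem generateStrictContactTorusAction_of_isFlow [IsManifold 𝓘(ℝ, E) ∞ M] [T2Space M]
    [CompleteSpace E] (hπ : IsPrincipalCircleBundle (E := E) (F := F) π)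
    (hα : IsConnectionForm α) (hcontact : IsContactForm α) (hY : IsLift π α H X Y)
    {Φ : ℝ × M → M} (hΦ : IsFlow Φ Y) (hper : ∀ x, Φ (2 * Real.pi, x) = x)
    (hΦα : ∀ t x, α.pullback (fun y => Φ (t, y)) x = α x) :
    GeneratesCircleAction Y ∧ GenerateStrictContactTorusAction α fundamentalVectorField Y := by
  have hsmooth := hπ.smooth_action
  obtain ⟨a, ha1, hamul, hasm, ha⟩ := hΦ.exists_circleAction hper
  have haY : ∀ x : M, IsMIntegralCurve (I := 𝓘(ℝ, E)) (fun t : ℝ => a (Circle.exp t) x) Y := by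
    intro x
    have : (fun t : ℝ => a (Circle.exp t) x) = fun t => Φ (t, x) := funext fun t => ha t x
    rw [this]
    exact hΦ.integralCurve x
  have hcomm : ∀ (w z : Circle) (x : M), a w (z • x) = z • a w x := by
    intro w z x
    obtain ⟨t, rfl⟩ := Circle.exp_surjective w
    rw [ha, ha, hY.flow_smul hπ hα hΦ]
  refine ⟨generatesCircleAction_of_contMDiff ha1 hamul hasm haY, hcontact, ?_⟩
  let torus : MulAction (Circle × Circle) M :=
    { smul := fun g x => g.1 • a g.2 x
      one_smul := fun x => by
        change (1 : Circle) • a 1 x = x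
        rw [one_smul]
        exact ha1 x
      mul_smul := fun g h x => by
        change (g.1 * h.1) • a (g.2 * h.2) x = g.1 • a g.2 (h.1 • a h.2 x)
        rw [hcomm, mul_smul]
        congr 2
        exact hamul g.2 h.2 x }
  refine ⟨torus, ⟨?_⟩, ?_, ?_, ?_⟩
  · have h1 : ContMDiff (((𝓡 1).prod (𝓡 1)).prod 𝓘(ℝ, E)) 𝓘(ℝ, E) ∞
        (fun p : (Circle × Circle) × M => a p.1.2 p.2) :=
      hasm.comp ((contMDiff_snd.comp contMDiff_fst).prodMk contMDiff_snd)
    exact (contMDiff_smul (I := 𝓡 1) (I' := 𝓘(ℝ, E)) (G := Circle)).comp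
      ((contMDiff_fst.comp contMDiff_fst).prodMk h1)
  · intro x t
    have h1 : ∀ s : ℝ, (torus.smul (Circle.exp s, 1) x) = Circle.exp s • x := fun s =>
      congrArg (fun y => Circle.exp s • y) (ha1 x)
    have h2 := hasMFDerivAt_exp_smul (E := E) t x
    have h3 : (fun s : ℝ => torus.smul (Circle.exp s, 1) x) = fun s => Circle.exp s • x :=
      funext h1
    change HasMFDerivAt 𝓘(ℝ, ℝ) 𝓘(ℝ, E) (fun s : ℝ => torus.smul (Circle.exp s, 1) x) t
      ((1 : ℝ →L[ℝ] ℝ).smulRight (fundamentalVectorField (torus.smul (Circle.exp t, 1) x)))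
    rw [h3, h1]
    exact h2
  · intro x
    have h3 : (fun s : ℝ => torus.smul (1, Circle.exp s) x) =
        fun s => a (Circle.exp s) x := by
      ext s; exact one_smul Circle _
    change IsMIntegralCurve (I := 𝓘(ℝ, E)) (fun s : ℝ => torus.smul (1, Circle.exp s) x) Y
    rw [h3]
    exact haY x
  · rintro ⟨z, w⟩ x
    obtain ⟨t, rfl⟩ := Circle.exp_surjective w
    have h3 : (fun y : M => torus.smul (z, Circle.exp t) y) = fun y => z • Φ (t, y) := by
      ext y; exact congrArg (fun u => z • u) (ha t y)
    change α.pullback (fun y : M => torus.smul (z, Circle.exp t) y) x = α x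
    rw [h3]
    refine Form.pullback_comp_eq (f := fun y => z • y) (g := fun y => Φ (t, y)) ?_ ?_
      (hα.invariant z _) (hΦα t x)
    · exact (contMDiff_circle_smul z).contMDiffAt.mdifferentiableAt (by simp)
    · exact ((hΦ.smooth.comp (contMDiff_const.prodMk contMDiff_id)).contMDiffAt (x := x)
        |>.mdifferentiableAt (by simp))

end Actions

end BoothbyWang

end

open BoothbyWang in
theorem mainTheorem5
    {F : Type*} [NormedAddCommGroup F] [NormedSpace ℝ F] [FiniteDimensional ℝ F]
    {B : Type*} [TopologicalSpace B] [ChartedSpace F B] [IsManifold 𝓘(ℝ, F) ∞ B]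
    [T2Space B] [CompactSpace B] [ConnectedSpace B]
    {E : Type*} [NormedAddCommGroup E] [NormedSpace ℝ E] [FiniteDimensional ℝ E]
    {M : Type*} [TopologicalSpace M] [ChartedSpace E M] [IsManifold 𝓘(ℝ, E) ∞ M]
    [T2Space M] [MulAction Circle M]
    (Ω : Form F B 2) (π : M → B) (α : Form E M 1) (hM : IsBoothbyWangBundle π α Ω)
    (H : B → ℝ) (hH : ContMDiff 𝓘(ℝ, F) 𝓘(ℝ, ℝ) ∞ H)
    (X : VectorField F B) (hX : IsHamiltonianVectorField Ω H X)
    (hXaction : GeneratesCircleAction X)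
    (hHpos : ∀ b, 0 < H b) (p₀ : B) (hp₀ : X p₀ = 0) (hHp₀ : ∃ m : ℕ, H p₀ = m)
    (R : VectorField E M) (hR : IsReebVectorField α R)
    (Xh : VectorField E M) (hXh : IsHorizontalLift π α X Xh) :
    GeneratesCircleAction (liftedVectorField π H R Xh) ∧
      GenerateStrictContactTorusAction α R (liftedVectorField π H R Xh) := by
  have : CompleteSpace E := FiniteDimensional.complete ℝ E
  have : CompleteSpace F := FiniteDimensional.complete ℝ F
  have hπ := hM.bundle
  have hα := hM.connection
  obtain ⟨ρ, hρ, hρper⟩ := hXaction.exists_isFlow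
  have hY : IsLift π α H X (liftedVectorField π H R Xh) := hM.isLift_liftedVectorField hR hXh
  obtain ⟨Φ, hΦ⟩ := hY.exists_isFlow hπ hα hH hρ
  have hΦα := hY.pullback_flow hπ hα hM.curvature hH hX hΦ
  have hper : ∀ x, Φ (2 * Real.pi, x) = x := by
    obtain ⟨x₀, hx₀⟩ := hπ.exists_proj_eq p₀
    obtain ⟨m, hm⟩ := hHp₀
    refine hα.eq_self_of_pullback_eq hπ (ψ := fun y => Φ (2 * Real.pi, y)) ?_ ?_ ?_
      (hΦα (2 * Real.pi)) (x₀ := x₀) ?_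
    · exact hΦ.smooth.comp (contMDiff_const.prodMk contMDiff_id)
    · intro x
      rw [hY.proj_flow hπ hΦ hρ, hρper]
    · exact fun z x => hY.flow_smul hπ hα hΦ _ z x
    · -- the flow rotates the fibre over `p₀` with integral speed
      rw [hY.flow_eq_of_eq_zero hπ hα hΦ (by rw [hx₀]; exact hp₀), hx₀, hm]
      have h1 : Circle.exp (2 * Real.pi * m) = 1 := mod_cast Circle.exp_two_pi_mul_int m
      rw [h1, one_smul]
  have hRfund : R = fundamentalVectorField := funext fun x => hM.reeb_eq hR x
  have key := generateStrictContactTorusAction_of_isFlow hπ hα (hM.isContactForm hR) hY hΦ hper hΦα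
  rwa [hRfund] at key ⊢
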